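/- **Spaces.** For $d\in\{2,3\}$ let $\mathscr A_d(n)=(\mathbb R^d)^n$ be the space of open $n$-edge polygons $(e_1,\dots,e_n)$ in $\mathbb R^d$ up to translation, $\mathscr P_d(n)=\{e\in\mathscr A_d(n):\sum_i e_i=0\}$ the linear subspace of closed polygons, and $\operatorname{Arm}_d(n)\subset\mathscr A_d(n)$, $\operatorname{Pol}_d(n)\subset\mathscr P_d(n)$ the subsets of polygons of total length $\sum_i|e_i|=2$. A real function $F$ on $\mathscr A_d(n)$ or $\mathscr P_d(n)$ is scale-invariant if $F(ce)=F(e)$ for all $c>0$ and all $e$. **Hopf map.** Let $\operatorname{Hopf}(q)=\bar q\,\mathbf i\,q$ for $q\in\mathbb H$, an imaginary quaternion, i.e. a vector of $\mathbb R^3$; extend it coordinatewise to $\mathbb H^n\to\mathscr A_3(n)$. It maps $\mathbb R^n\oplus\mathbf j\mathbb R^n$ and $\mathbf i\mathbb R^n\oplus\mathbf k\mathbb R^n$ (each identified with $\mathbb C^n=\mathbb R^{2n}$) to $\mathscr A_2(n)$, with $\mathbb R^2$ the $\mathbf i,\mathbf k$-plane. **Hopf-Gaussian measure $\mathrm H$.**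 On $\mathscr A_3(n)$ it is the pushforward by $\operatorname{Hopf}$ of the standard Gaussian measure on $\mathbb H^n=\mathbb R^{4n}$. On $\mathscr A_2(n)$ it is the pushforward of the probability measure on $(\mathbb R^n\oplus\mathbf j\mathbb R^n)\cup(\mathbf i\mathbb R^n\oplus\mathbf k\mathbb R^n)$ that is one half of the standard Gaussian measure on each piece. On $\mathscr P_d(n)$ it is the subspace measure inherited from $\mathscr A_d(n)$, i.e. $\mathrm H$ conditioned on closure: the weak limit, as $\varepsilon\downarrow0$, of the conditional laws $\mathrm H(\,\cdot\mid |\sum_i e_i|<\varepsilon)$. **Symmetric measure $\sigma$.** It is the pushforward by $\operatorname{Hopf}$ of the invariant probability measure on a model space: for $\operatorname{Arm}_3(n)$ the sphere of radius $\sqrt2$ in $\mathbb H^n$; for $\operatorname{Arm}_2(n)$ the disjoint union of the spheres of radius $\sqrt2$ in $\mathbb R^n\oplus\mathbf j\mathbb R^n$ and $\mathbf i\mathbb R^n\oplus\mathbf k\mathbb R^n$, with mass $\tfrac12$ each; for $\operatorname{Pol}_3(n)$ the Stiefel manifold $V_2(\mathbb C^n)$ of Hermitian orthonormal 2-frames $(u,v)$,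 embedded in $\mathbb H^n$ as $u+v\mathbf j$, with its $U(n)$-invariant (Haar) probability measure; for $\operatorname{Pol}_2(n)$ the disjoint union of the real Stiefel manifold $V_2(\mathbb R^n)\subset\mathbb R^n\oplus\mathbf j\mathbb R^n$ (again $(u,v)\mapsto u+v\mathbf j$) and $\mathbf iV_2(\mathbb R^n)$, each with one half of its $O(n)$-invariant probability measure. **Theorem 2.** Let $d\in\{2,3\}$. 1. Let $n\ge1$ and let $F:\mathscr A_d(n)\to\mathbb R$ be scale-invariant. Then $F$ is $\mathrm H$-integrable if and only if its restriction to $\operatorname{Arm}_d(n)$ is $\sigma$-integrable, and in that case $$E(F;\mathscr A_d(n),\mathrm H)=E(F;\operatorname{Arm}_d(n),\sigma).$$ 2. Let $n\ge3$ (for $d=3$, $n\ge2$ suffices). Then the Hopf-Gaussian measure on $\mathscr P_d(n)$ is well defined (the weak limit exists and is a probability measure on $\mathscr P_d(n)$). If $F:\mathscr P_d(n)\to\mathbb R$ is scale-invariant, then $F$ is $\mathrm H$-integrable if and only if its restriction to $\operatorname{Pol}_d(n)$ is $\sigma$-integrable, and in that case $$E(F;\mathscr P_d(n),\mathrm H)=E(F;\operatorname{Pol}_d(n),\sigma).$$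 -/

import Mathlib

open MeasureTheory ProbabilityTheory Filter Topology
open scoped Quaternion ENNReal BoundedContinuousFunction

noncomputable section

namespace HopfPolygon

/-! ### Polygon spaces -/

/-- Open `n`-edge polygons in `ℝ^d` up to translation, recorded by their edge vectors. -/
abbrev Arms (d n : ℕ) : Type := Fin n → EuclideanSpace ℝ (Fin d)

/-- Closed `n`-edge polygons in `ℝ^d` up to translation: the linear subspace of `Arms d n` on which
the edge vectors sum to zero. -/
def Polygons (d n : ℕ) : Submodule ℝ (Arms d n) where
  carrier := {e | ∑ i, e i = 0}
  add_mem' {a b} ha hb := by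
    change ∑ i, (a + b) i = 0
    simp only [Pi.add_apply, Finset.sum_add_distrib]
    rw [show ∑ i, a i = 0 from ha, show ∑ i, b i = 0 from hb, add_zero]
  zero_mem' := by simp
  smul_mem' c a ha := by
    change ∑ i, (c • a) i = 0
    simp only [Pi.smul_apply, ← Finset.smul_sum]
    rw [show ∑ i, a i = 0 from ha, smul_zero]

/-- Open polygons of total length `2`. -/
def Arm (d n : ℕ) : Set (Arms d n) := {e | ∑ i, ‖e i‖ = 2}

/-- Closed polygons of total length `2`. -/
def Pol (d n : ℕ) : Set (Polygons d n) := {p | ∑ i, ‖(p : Arms d n) i‖ = 2}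

/-- Scale invariance: the value does not change under dilation by a positive factor. -/
def ScaleInvariant {V : Type*} [SMul ℝ V] (F : V → ℝ) : Prop :=
  ∀ c : ℝ, 0 < c → ∀ x : V, F (c • x) = F x

/-! ### The Hopf map -/

/-- The quaternion unit `i`. -/
def qI : ℍ[ℝ] := ⟨0, 1, 0, 0⟩

/-- The Hopf map `q ↦ q̄ i q`; its values are imaginary quaternions. -/
def hopf (q : ℍ[ℝ]) : ℍ[ℝ] := star q * qI * q

lemma hopf_coord (q : ℍ[ℝ]) :
    (hopf q).imI = q.re ^ 2 + q.imI ^ 2 - q.imJ ^ 2 - q.imK ^ 2 ∧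
    (hopf q).imJ = 2 * q.imI * q.imJ - 2 * q.re * q.imK ∧
    (hopf q).imK = 2 * q.re * q.imJ + 2 * q.imI * q.imK := by
  have h0 : qI.re = 0 := rfl
  have h1 : qI.imI = 1 := rfl
  have h2 : qI.imJ = 0 := rfl
  have h3 : qI.imK = 0 := rfl
  refine ⟨?_, ?_, ?_⟩ <;> simp [hopf, h0, h1, h2, h3] <;> ring

/-- The coordinatewise Hopf map `ℍ^n → (ℝ³)^n`, with `ℝ³` the span of `i, j, k`. -/
def hopfSpace {n : ℕ} (q : Fin n → ℍ[ℝ]) : Arms 3 n :=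
  fun m => !₂[(hopf (q m)).imI, (hopf (q m)).imJ, (hopf (q m)).imK]

/-- The coordinatewise Hopf map followed by the coordinates in the plane spanned by `i, k`. It is
applied only to `ℝ^n ⊕ jℝ^n` and `iℝ^n ⊕ kℝ^n`, which the Hopf map sends into that plane. -/
def hopfPlane {n : ℕ} (q : Fin n → ℍ[ℝ]) : Arms 2 n :=
  fun m => !₂[(hopf (q m)).imI, (hopf (q m)).imK]

/-- `ℍ^n` from its real coordinates. -/
def quat {n : ℕ} (x : EuclideanSpace ℝ (Fin n × Fin 4)) : Fin n → ℍ[ℝ] :=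
  fun m => ⟨x (m, 0), x (m, 1), x (m, 2), x (m, 3)⟩

/-- The vector `a + b j` of `ℝ^n ⊕ jℝ^n`. -/
def sheetOne {n : ℕ} (a b : Fin n → ℝ) : Fin n → ℍ[ℝ] := fun m => ⟨a m, 0, b m, 0⟩

/-- The vector `i (a + b j) = a i + b k` of `iℝ^n ⊕ kℝ^n`. -/
def sheetTwo {n : ℕ} (a b : Fin n → ℝ) : Fin n → ℍ[ℝ] := fun m => qI * sheetOne a b m

/-! ### The Hopf-Gaussian measures -/

/-- The Hopf-Gaussian measure on open space polygons: the pushforward by the Hopf map of the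
standard Gaussian measure on `ℍ^n = ℝ^{4n}`. -/
def hopfGaussianSpace (n : ℕ) : Measure (Arms 3 n) :=
  (stdGaussian (EuclideanSpace ℝ (Fin n × Fin 4))).map fun x => hopfSpace (quat x)

/-- The Hopf-Gaussian measure on open planar polygons: the pushforward by the Hopf map of the
probability measure on `(ℝ^n ⊕ jℝ^n) ∪ (iℝ^n ⊕ kℝ^n)` that is half the standard Gaussian measure
of `ℂ^n = ℝ^{2n}` on each of the two pieces. -/
def hopfGaussianPlane (n : ℕ) : Measure (Arms 2 n) :=
  (2⁻¹ : ℝ≥0∞) •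
    ((stdGaussian (EuclideanSpace ℝ (Fin n × Fin 2))).map
        (fun z => hopfPlane (sheetOne (fun m => z (m, 0)) (fun m => z (m, 1)))) +
      (stdGaussian (EuclideanSpace ℝ (Fin n × Fin 2))).map
        (fun z => hopfPlane (sheetTwo (fun m => z (m, 0)) (fun m => z (m, 1)))))

/-- `ν` is the law of a `μ`-random open polygon conditioned on closure: the probability measure on
closed polygons to which the laws `μ( · | ‖e₁ + ⋯ + eₙ‖ < ε)` converge weakly as `ε → 0`. -/
def IsSubspaceMeasure {d n : ℕ} (μ : Measure (Arms d n)) (ν : Measure (Polygons d n)) : Prop :=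
  IsProbabilityMeasure ν ∧
    ∀ f : Arms d n →ᵇ ℝ,
      Tendsto (fun ε : ℝ => ∫ e, f e ∂(cond μ {e : Arms d n | ‖∑ i, e i‖ < ε})) (𝓝[>] 0)
        (𝓝 (∫ p : Polygons d n, f (p : Arms d n) ∂ν))

open Classical in
/-- The subspace measure on closed polygons inherited from `μ` (zero if there is none; there is at
most one). -/
def subspaceMeasure {d n : ℕ} (μ : Measure (Arms d n)) : Measure (Polygons d n) :=
  if h : ∃ ν : Measure (Polygons d n), IsSubspaceMeasure μ ν then h.choose else 0

/-! ### The symmetric measures on open polygons -/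

/-- The uniform probability measure on the unit sphere of `ℝ^ι`. -/
def uniformSphere (ι : Type) [Fintype ι] :
    Measure (Metric.sphere (0 : EuclideanSpace ℝ ι) 1) :=
  ((volume : Measure (EuclideanSpace ℝ ι)).toSphere Set.univ)⁻¹ •
    (volume : Measure (EuclideanSpace ℝ ι)).toSphere

lemma norm_hopfSpace {n : ℕ} (q : Fin n → ℍ[ℝ]) (m : Fin n) :
    ‖hopfSpace q m‖ = (q m).re ^ 2 + (q m).imI ^ 2 + (q m).imJ ^ 2 + (q m).imK ^ 2 := by
  obtain ⟨h1, h2, h3⟩ := hopf_coord (q m)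
  rw [EuclideanSpace.norm_eq, Real.sqrt_eq_iff_mul_self_eq (by positivity) (by positivity)]
  simp [Fin.sum_univ_three, hopfSpace, h1, h2, h3]
  ring

lemma norm_hopfPlane_sheetOne {n : ℕ} (a b : Fin n → ℝ) (m : Fin n) :
    ‖hopfPlane (sheetOne a b) m‖ = a m ^ 2 + b m ^ 2 := by
  obtain ⟨h1, -, h3⟩ := hopf_coord (sheetOne a b m)
  rw [EuclideanSpace.norm_eq, Real.sqrt_eq_iff_mul_self_eq (by positivity) (by positivity)]
  simp only [Fin.sum_univ_two, hopfPlane, h1, h3]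
  simp [sheetOne, mul_pow]
  ring

lemma hopfPlane_sheetTwo {n : ℕ} (a b : Fin n → ℝ) :
    hopfPlane (sheetTwo a b) = hopfPlane (sheetOne a b) := by
  have h : ∀ m, hopf (sheetTwo a b m) = hopf (sheetOne a b m) := by
    intro m
    have hI : star qI * qI = 1 := by
      have h0 : qI.re = 0 := rfl
      have h1 : qI.imI = 1 := rfl
      have h2 : qI.imJ = 0 := rfl
      have h3 : qI.imK = 0 := rfl
      ext <;> simp [h0, h1, h2, h3]
    simp only [hopf, sheetTwo, star_mul]
    rw [mul_assoc (star (sheetOne a b m)), hI, mul_one, ← mul_assoc]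
  funext m
  simp only [hopfPlane, h]

lemma sum_sq_sphere {ι : Type} [Fintype ι] (x : Metric.sphere (0 : EuclideanSpace ℝ ι) 1) :
    ∑ l, ((√2 • (x : EuclideanSpace ℝ ι)) l) ^ 2 = 2 := by
  have h : ‖(x : EuclideanSpace ℝ ι)‖ ^ 2 = 1 := by simp
  rw [EuclideanSpace.norm_sq_eq] at h
  simp only [Real.norm_eq_abs, sq_abs] at h
  simp [mul_pow, ← Finset.mul_sum, h]

/-- The Hopf map from the sphere of radius `√2` in `ℍ^n`, parametrized by the unit sphere, to open
space polygons of length `2`. -/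
def sphereToArmSpace (n : ℕ) (x : Metric.sphere (0 : EuclideanSpace ℝ (Fin n × Fin 4)) 1) :
    Arm 3 n :=
  ⟨hopfSpace (quat (√2 • (x : EuclideanSpace ℝ (Fin n × Fin 4)))), by
    have h := sum_sq_sphere x
    rw [Fintype.sum_prod_type] at h
    change ∑ m, ‖hopfSpace (quat (√2 • (x : EuclideanSpace ℝ (Fin n × Fin 4)))) m‖ = 2
    simpa only [norm_hopfSpace, quat, Fin.sum_univ_four] using h⟩

/-- The Hopf map from the sphere of radius `√2` in `ℝ^n ⊕ jℝ^n` to open planar polygons. -/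
def sphereToArmPlaneOne (n : ℕ)
    (x : Metric.sphere (0 : EuclideanSpace ℝ (Fin n × Fin 2)) 1) : Arm 2 n :=
  ⟨hopfPlane (sheetOne (fun m => (√2 • (x : EuclideanSpace ℝ (Fin n × Fin 2))) (m, 0))
      (fun m => (√2 • (x : EuclideanSpace ℝ (Fin n × Fin 2))) (m, 1))), by
    have h := sum_sq_sphere x
    rw [Fintype.sum_prod_type] at h
    change ∑ m, ‖hopfPlane _ m‖ = 2
    simpa only [norm_hopfPlane_sheetOne, Fin.sum_univ_two] using h⟩

/-- The Hopf map from the sphere of radius `√2` in `iℝ^n ⊕ kℝ^n` to open planar polygons. -/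
def sphereToArmPlaneTwo (n : ℕ)
    (x : Metric.sphere (0 : EuclideanSpace ℝ (Fin n × Fin 2)) 1) : Arm 2 n :=
  ⟨hopfPlane (sheetTwo (fun m => (√2 • (x : EuclideanSpace ℝ (Fin n × Fin 2))) (m, 0))
      (fun m => (√2 • (x : EuclideanSpace ℝ (Fin n × Fin 2))) (m, 1))), by
    rw [hopfPlane_sheetTwo]
    exact (sphereToArmPlaneOne n x).2⟩

/-- The symmetric measure on open space polygons of length `2`. -/
def symmetricArmSpace (n : ℕ) : Measure (Arm 3 n) :=
  (uniformSphere (Fin n × Fin 4)).map (sphereToArmSpace n)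

/-- The symmetric measure on open planar polygons of length `2`: the pushforward of the uniform
probability measure on the disjoint union of two spheres. -/
def symmetricArmPlane (n : ℕ) : Measure (Arm 2 n) :=
  (2⁻¹ : ℝ≥0∞) •
    ((uniformSphere (Fin n × Fin 2)).map (sphereToArmPlaneOne n) +
      (uniformSphere (Fin n × Fin 2)).map (sphereToArmPlaneTwo n))

/-! ### The symmetric measures on closed polygons -/

/-- The Stiefel manifold of (Hermitian) orthonormal 2-frames in `𝕜^n`. -/
def Stiefel (𝕜 : Type) [RCLike 𝕜] (n : ℕ) :
    Set (EuclideanSpace 𝕜 (Fin n) × EuclideanSpace 𝕜 (Fin n)) :=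
  {p | ‖p.1‖ = 1 ∧ ‖p.2‖ = 1 ∧ inner 𝕜 p.1 p.2 = 0}

instance compactSpace_unitaryGroup (𝕜 : Type) [RCLike 𝕜] (n : ℕ) :
    CompactSpace (Matrix.unitaryGroup (Fin n) 𝕜) := by
  refine isCompact_iff_compactSpace.1 (?_ : IsCompact
    (Matrix.unitaryGroup (Fin n) 𝕜 : Set (Matrix (Fin n) (Fin n) 𝕜)))
  have hK : IsCompact (Set.univ.pi fun _ : Fin n => Set.univ.pi fun _ : Fin n =>
      Metric.closedBall (0 : 𝕜) 1) :=
    isCompact_univ_pi fun _ => isCompact_univ_pi fun _ => isCompact_closedBall _ _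
  refine IsCompact.of_isClosed_subset hK (isClosed_unitary (R := Matrix (Fin n) (Fin n) 𝕜)) ?_
  intro U hU
  refine Set.mem_univ_pi.2 fun i => Set.mem_univ_pi.2 fun j => ?_
  rw [Metric.mem_closedBall, dist_zero_right]
  exact entry_norm_bound_of_unitary hU i j

instance measurableSpace_unitaryGroup (𝕜 : Type) [RCLike 𝕜] (n : ℕ) :
    MeasurableSpace (Matrix.unitaryGroup (Fin n) 𝕜) := borel _

instance borelSpace_unitaryGroup (𝕜 : Type) [RCLike 𝕜] (n : ℕ) :
    BorelSpace (Matrix.unitaryGroup (Fin n) 𝕜) := ⟨rfl⟩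

/-- The orbit map `U ↦ (U e₁, U e₂)` from the unitary (orthogonal) group to the Stiefel manifold. -/
def frame (𝕜 : Type) [RCLike 𝕜] {n : ℕ} (hn : 2 ≤ n) (U : Matrix.unitaryGroup (Fin n) 𝕜) :
    Stiefel 𝕜 n :=
  ⟨(WithLp.toLp 2 fun m => (U : Matrix (Fin n) (Fin n) 𝕜) m (Fin.castLE hn 0),
    WithLp.toLp 2 fun m => (U : Matrix (Fin n) (Fin n) 𝕜) m (Fin.castLE hn 1)), by
    have key : ∀ k l : Fin n,
        inner 𝕜 (WithLp.toLp 2 fun m => (U : Matrix (Fin n) (Fin n) 𝕜) m k :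
            EuclideanSpace 𝕜 (Fin n))
          (WithLp.toLp 2 fun m => (U : Matrix (Fin n) (Fin n) 𝕜) m l) =
          (1 : Matrix (Fin n) (Fin n) 𝕜) k l := by
      intro k l
      rw [← Matrix.UnitaryGroup.star_mul_self U]
      simp [PiLp.inner_apply, Matrix.mul_apply, Matrix.star_apply, mul_comm]
    have nrm : ∀ k : Fin n, ‖(WithLp.toLp 2 fun m => (U : Matrix (Fin n) (Fin n) 𝕜) m k :
        EuclideanSpace 𝕜 (Fin n))‖ = 1 := by
      intro k
      rw [norm_eq_sqrt_re_inner (𝕜 := 𝕜), key k k]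
      simp
    refine ⟨nrm _, nrm _, ?_⟩
    rw [key]
    simp [Fin.ext_iff]⟩

/-- The invariant (Haar) probability measure on the Stiefel manifold, a homogeneous space of the
unitary (orthogonal) group. -/
def stiefelHaar (𝕜 : Type) [RCLike 𝕜] {n : ℕ} (hn : 2 ≤ n) : Measure (Stiefel 𝕜 n) :=
  (Measure.haarMeasure (⊤ : TopologicalSpace.PositiveCompacts (Matrix.unitaryGroup (Fin n) 𝕜))).map
    (frame 𝕜 hn)

/-- The vector `u + v j` of `ℍ^n` for `u, v ∈ ℂ^n`. -/
def complexPair {n : ℕ} (u v : EuclideanSpace ℂ (Fin n)) : Fin n → ℍ[ℝ] :=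
  fun m => ⟨(u m).re, (u m).im, (v m).re, (v m).im⟩

lemma stiefel_complex {n : ℕ} (p : Stiefel ℂ n) :
    ∑ m, ((p.1.1 m).re ^ 2 + (p.1.1 m).im ^ 2) = 1 ∧
    ∑ m, ((p.1.2 m).re ^ 2 + (p.1.2 m).im ^ 2) = 1 ∧
    ∑ m, ((p.1.1 m).re * (p.1.2 m).re + (p.1.1 m).im * (p.1.2 m).im) = 0 ∧
    ∑ m, ((p.1.1 m).im * (p.1.2 m).re - (p.1.1 m).re * (p.1.2 m).im) = 0 := by
  obtain ⟨⟨u, v⟩, hu, hv, huv⟩ := p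
  have sq : ∀ w : EuclideanSpace ℂ (Fin n), ‖w‖ = 1 →
      ∑ m, ((w m).re ^ 2 + (w m).im ^ 2) = 1 := by
    intro w hw
    have h := EuclideanSpace.norm_sq_eq w
    rw [hw] at h
    simpa [Complex.sq_norm, Complex.normSq_apply, ← sq] using h.symm
  refine ⟨sq u hu, sq v hv, ?_, ?_⟩
  · have h := congrArg Complex.re huv
    simp only [PiLp.inner_apply, Complex.re_sum] at h
    simpa [mul_comm] using h
  · have h := congrArg Complex.im huv
    simp only [PiLp.inner_apply, Complex.im_sum] at h
    rw [← neg_eq_zero, ← Finset.sum_neg_distrib]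
    refine Eq.trans (Finset.sum_congr rfl fun m _ => ?_) h
    simp
    ring

lemma stiefel_real {n : ℕ} (p : Stiefel ℝ n) :
    ∑ m, (p.1.1 m) ^ 2 = 1 ∧ ∑ m, (p.1.2 m) ^ 2 = 1 ∧ ∑ m, p.1.1 m * p.1.2 m = 0 := by
  obtain ⟨⟨u, v⟩, hu, hv, huv⟩ := p
  have sq : ∀ w : EuclideanSpace ℝ (Fin n), ‖w‖ = 1 → ∑ m, (w m) ^ 2 = 1 := by
    intro w hw
    have h := EuclideanSpace.norm_sq_eq w
    rw [hw] at h
    simpa using h.symm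
  refine ⟨sq u hu, sq v hv, ?_⟩
  simpa [PiLp.inner_apply, mul_comm] using huv

/-- The Hopf map from `V₂(ℂ^n)` to closed space polygons of length `2`. -/
def stiefelToPolSpace (n : ℕ) (p : Stiefel ℂ n) : Pol 3 n :=
  ⟨⟨hopfSpace (complexPair p.1.1 p.1.2), by
    obtain ⟨h1, h2, h3, h4⟩ := stiefel_complex p
    change ∑ m, hopfSpace (complexPair p.1.1 p.1.2) m = 0
    ext l
    fin_cases l
    · refine Eq.trans ?_ (sub_eq_zero.2 (h1.trans h2.symm))
      rw [← Finset.sum_sub_distrib]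
      simp only [WithLp.ofLp_sum, Finset.sum_apply]
      refine Finset.sum_congr rfl fun m _ => ?_
      obtain ⟨c1, c2, c3⟩ := hopf_coord (complexPair p.1.1 p.1.2 m)
      simp only [hopfSpace, c1, c2, c3]
      simp [complexPair]
      ring
    · refine Eq.trans ?_ ((congrArg (fun t : ℝ => 2 * t) h4).trans (mul_zero 2))
      simp only [Finset.mul_sum]
      simp only [WithLp.ofLp_sum, Finset.sum_apply]
      refine Finset.sum_congr rfl fun m _ => ?_
      obtain ⟨c1, c2, c3⟩ := hopf_coord (complexPair p.1.1 p.1.2 m)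
      simp only [hopfSpace, c1, c2, c3]
      simp [complexPair]
      ring
    · refine Eq.trans ?_ ((congrArg (fun t : ℝ => 2 * t) h3).trans (mul_zero 2))
      simp only [Finset.mul_sum]
      simp only [WithLp.ofLp_sum, Finset.sum_apply]
      refine Finset.sum_congr rfl fun m _ => ?_
      obtain ⟨c1, c2, c3⟩ := hopf_coord (complexPair p.1.1 p.1.2 m)
      simp only [hopfSpace, c1, c2, c3]
      simp [complexPair]
      ring⟩, by
    obtain ⟨h1, h2, -, -⟩ := stiefel_complex p
    change ∑ m, ‖hopfSpace (complexPair p.1.1 p.1.2) m‖ = 2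
    refine Eq.trans ?_ ((congrArg₂ (· + ·) h1 h2).trans one_add_one_eq_two)
    simp only [← Finset.sum_add_distrib]
    refine Finset.sum_congr rfl fun m _ => ?_
    rw [norm_hopfSpace]
    simp only [complexPair]
    ring⟩

/-- The Hopf map from `V₂(ℝ^n) ⊆ ℝ^n ⊕ jℝ^n` to closed planar polygons of length `2`. -/
def stiefelToPolPlaneOne (n : ℕ) (p : Stiefel ℝ n) : Pol 2 n :=
  ⟨⟨hopfPlane (sheetOne p.1.1 p.1.2), by
    obtain ⟨h1, h2, h3⟩ := stiefel_real p
    change ∑ m, hopfPlane (sheetOne p.1.1 p.1.2) m = 0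
    ext l
    fin_cases l
    · refine Eq.trans ?_ (sub_eq_zero.2 (h1.trans h2.symm))
      rw [← Finset.sum_sub_distrib]
      simp only [WithLp.ofLp_sum, Finset.sum_apply]
      refine Finset.sum_congr rfl fun m _ => ?_
      obtain ⟨c1, -, c3⟩ := hopf_coord (sheetOne p.1.1 p.1.2 m)
      simp only [hopfPlane, c1, c3]
      simp [sheetOne]
    · refine Eq.trans ?_ ((congrArg (fun t : ℝ => 2 * t) h3).trans (mul_zero 2))
      simp only [Finset.mul_sum]
      simp only [WithLp.ofLp_sum, Finset.sum_apply]
      refine Finset.sum_congr rfl fun m _ => ?_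
      obtain ⟨c1, -, c3⟩ := hopf_coord (sheetOne p.1.1 p.1.2 m)
      simp only [hopfPlane, c1, c3]
      simp [sheetOne]
      ring⟩, by
    obtain ⟨h1, h2, -⟩ := stiefel_real p
    change ∑ m, ‖hopfPlane (sheetOne p.1.1 p.1.2) m‖ = 2
    simp only [norm_hopfPlane_sheetOne, Finset.sum_add_distrib, h1, h2]
    norm_num⟩

/-- The Hopf map from `i V₂(ℝ^n) ⊆ iℝ^n ⊕ kℝ^n` to closed planar polygons of length `2`. -/
def stiefelToPolPlaneTwo (n : ℕ) (p : Stiefel ℝ n) : Pol 2 n :=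
  ⟨⟨hopfPlane (sheetTwo p.1.1 p.1.2), by
    rw [hopfPlane_sheetTwo]
    exact (stiefelToPolPlaneOne n p).1.2⟩, by
    simp only [hopfPlane_sheetTwo]
    exact (stiefelToPolPlaneOne n p).2⟩

/-- The symmetric measure on closed space polygons of length `2`. -/
def symmetricPolSpace {n : ℕ} (hn : 2 ≤ n) : Measure (Pol 3 n) :=
  (stiefelHaar ℂ hn).map (stiefelToPolSpace n)

/-- The symmetric measure on closed planar polygons of length `2`: the pushforward of the invariant
probability measure on the disjoint union of `V₂(ℝ^n)` and `i V₂(ℝ^n)`. -/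
def symmetricPolPlane {n : ℕ} (hn : 2 ≤ n) : Measure (Pol 2 n) :=
  (2⁻¹ : ℝ≥0∞) •
    ((stiefelHaar ℝ hn).map (stiefelToPolPlaneOne n) +
      (stiefelHaar ℝ hn).map (stiefelToPolPlaneTwo n))

end HopfPolygon

end

/-!
In polar coordinates the Gaussian law on the model space is a random dilation of the uniform law on
the sphere. The Hopf map is quadratic, so the law of the random polygon is a random positive
dilation of the symmetric law, and a scale-invariant function does not see the dilation.

For closed polygons, write the quaternions as `u + v j`; the sum of the edges is, up to an isometry,
the closing vector `(2⟪u, v⟫, ‖u‖² - ‖v‖²)`, so the polygon closes exactly when `u` and `v` are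
orthogonal of equal length. Together, `‖u‖` and the closing vector determine the pair up to a
unitary matrix, hence conditional expectations may first be averaged over unitary orbits. Splitting
`v` along `u` shows that, given `‖u‖`, the closing vector has an explicit density, a Gaussian
density times a Gamma density up to a change of variables. In the stated dimensions it is dominated
by an integrable function of `‖u‖` and is continuous at `0`, so the conditional laws converge to the
law of the polygon of a random dilation of a Haar distributed orthonormal frame.
-/

namespace HopfPolygon

section Measure

variable {α β : Type*} [MeasurableSpace α] [MeasurableSpace β]

lemma withDensity_map {μ : Measure α} {f : α → β} (hf : Measurable f) {g : β → ℝ≥0∞}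
    (hg : Measurable g) : (μ.map f).withDensity g = (μ.withDensity (g ∘ f)).map f := by
  ext s hs
  rw [withDensity_apply _ hs, Measure.map_apply hf hs, withDensity_apply _ (hf hs),
    setLIntegral_map hs hg hf]
  rfl

lemma cond_map {μ : Measure α} {f : α → β} (hf : Measurable f) {s : Set β}
    (hs : MeasurableSet s) : (μ.map f)[|s] = μ[|f ⁻¹' s].map f := by
  rw [ProbabilityTheory.cond, ProbabilityTheory.cond, Measure.map_apply hf hs,
    Measure.restrict_map hf hs, Measure.map_smul]

lemma inv_two_smul_add_self (μ : Measure α) : (2⁻¹ : ℝ≥0∞) • (μ + μ) = μ := by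
  rw [← two_smul ℝ≥0∞ μ, smul_smul, ENNReal.inv_mul_cancel (by norm_num) (by norm_num), one_smul]

end Measure

section PolarCoordinates

lemma volume_eq_map_toSphere_prod (E : Type*) [NormedAddCommGroup E] [InnerProductSpace ℝ E]
    [FiniteDimensional ℝ E] [MeasurableSpace E] [BorelSpace E] [Nontrivial E] :
    (volume : Measure E) = ((volume : Measure E).toSphere.prod
      (Measure.volumeIoiPow (Module.finrank ℝ E - 1))).map fun p => (p.2 : ℝ) • (p.1 : E) := by
  have hsymm := ((volume : Measure E).measurePreserving_homeomorphUnitSphereProd.symm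
    (homeomorphUnitSphereProd E).toMeasurableEquiv).map_eq
  have hcomp : (fun p : Metric.sphere (0 : E) 1 × Set.Ioi (0 : ℝ) => (p.2 : ℝ) • (p.1 : E)) =
      Subtype.val ∘ (homeomorphUnitSphereProd E).toMeasurableEquiv.symm :=
    funext fun p => (homeomorphUnitSphereProd_symm_apply_coe E p).symm
  rw [hcomp, ← Measure.map_map measurable_subtype_coe (MeasurableEquiv.measurable _), hsymm,
    (MeasurableEmbedding.subtype_coe (measurableSet_singleton _).compl).map_comap,
    Subtype.range_coe, restrict_compl_singleton]

variable {ι : Type} [Fintype ι] [Nonempty ι]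

lemma toSphere_univ_ne_zero :
    (volume : Measure (EuclideanSpace ℝ ι)).toSphere Set.univ ≠ 0 := by
  rw [Ne, Measure.measure_univ_eq_zero]
  exact Measure.toSphere_ne_zero _

instance isProbabilityMeasure_uniformSphere : IsProbabilityMeasure (uniformSphere ι) where
  measure_univ := by
    rw [uniformSphere, Measure.smul_apply, smul_eq_mul]
    exact ENNReal.inv_mul_cancel toSphere_univ_ne_zero (measure_ne_top _ _)

theorem exists_eq_map_uniformSphere_prod {f : ℝ → ℝ≥0∞} (hf : Measurable f)
    {μ : Measure (EuclideanSpace ℝ ι)} [IsProbabilityMeasure μ]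
    (hμ : μ = volume.withDensity fun x => f ‖x‖) :
    ∃ ρ : Measure ℝ, IsProbabilityMeasure ρ ∧ (∀ᵐ r ∂ρ, 0 < r) ∧
      μ = ((uniformSphere ι).prod ρ).map fun p => p.2 • (p.1 : EuclideanSpace ℝ ι) := by
  let E := EuclideanSpace ℝ ι
  let T := (volume : Measure E).toSphere
  let κ := (Measure.volumeIoiPow (Module.finrank ℝ E - 1)).withDensity fun r => f r
  have hf' : Measurable fun r : Set.Ioi (0 : ℝ) => f r := hf.comp measurable_subtype_coe
  have hT : T = T Set.univ • uniformSphere ι := by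
    rw [uniformSphere, smul_smul, ENNReal.mul_inv_cancel toSphere_univ_ne_zero
      (measure_ne_top _ _), one_smul]
  have hM : Measurable fun p : Metric.sphere (0 : E) 1 × ℝ => p.2 • (p.1 : E) := by fun_prop
  have hpolar : μ = (T.prod κ).map fun p => (p.2 : ℝ) • (p.1 : E) := by
    rw [hμ, volume_eq_map_toSphere_prod E, prod_withDensity_right hf']
    refine (withDensity_map (by fun_prop) (hf.comp measurable_norm)).trans ?_
    congr 2
    funext p
    simp [norm_smul, abs_of_pos (Set.mem_Ioi.1 p.2.2)]
  have hμρ : μ = ((uniformSphere ι).prod ((T Set.univ • κ).map Subtype.val)).map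
      fun p => p.2 • (p.1 : E) := by
    have hprod := Measure.map_prod_map (uniformSphere ι) (T Set.univ • κ) measurable_id
      measurable_subtype_coe
    rw [Measure.map_id] at hprod
    rw [hprod, Measure.map_map hM (by fun_prop), Measure.prod_smul_right, ← Measure.prod_smul_left,
      ← hT]
    exact hpolar
  refine ⟨(T Set.univ • κ).map Subtype.val, ⟨?_⟩, ?_, hμρ⟩
  · have huniv : μ Set.univ = 1 := measure_univ
    rw [hμρ, Measure.map_apply hM .univ, Set.preimage_univ, ← Set.univ_prod_univ,
      Measure.prod_prod, measure_univ, one_mul] at huniv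
    exact huniv
  · rw [ae_map_iff measurable_subtype_coe.aemeasurable measurableSet_Ioi]
    exact Eventually.of_forall fun r => r.2

end PolarCoordinates

section Gaussian

variable {E : Type*} [NormedAddCommGroup E] [InnerProductSpace ℝ E]

/-- The density of the standard Gaussian measure with respect to Lebesgue measure. -/
noncomputable def stdGaussianPDF (x : E) : ℝ :=
  (2 * Real.pi) ^ (-(Module.finrank ℝ E : ℝ) / 2) * Real.exp (-‖x‖ ^ 2 / 2)

lemma stdGaussianPDF_pos (x : E) : 0 < stdGaussianPDF x := by
  unfold stdGaussianPDF
  positivity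

lemma stdGaussianPDF_le (x : E) :
    stdGaussianPDF x ≤ (2 * Real.pi) ^ (-(Module.finrank ℝ E : ℝ) / 2) :=
  mul_le_of_le_one_right (by positivity) (Real.exp_le_one_iff.2 (by nlinarith [sq_nonneg ‖x‖]))

@[fun_prop]
lemma continuous_stdGaussianPDF : Continuous (stdGaussianPDF : E → ℝ) := by
  unfold stdGaussianPDF
  fun_prop

variable [FiniteDimensional ℝ E] [MeasurableSpace E] [BorelSpace E]

lemma integrable_stdGaussianPDF : Integrable (stdGaussianPDF : E → ℝ) := by
  have h := (GaussianFourier.integrable_cexp_neg_mul_sq_norm_add (V := E) (b := 1 / 2)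
    (by norm_num) 0 0).norm
  refine (h.congr (Eventually.of_forall fun x => ?_)).const_mul _
  have hexponent : -(1 / 2) * (‖x‖ : ℂ) ^ 2 + 0 * (inner ℝ (0 : E) x : ℝ) =
      ((-‖x‖ ^ 2 / 2 : ℝ) : ℂ) := by
    push_cast
    ring
  beta_reduce
  rw [hexponent, Complex.norm_exp, Complex.ofReal_re]

lemma integral_stdGaussianPDF_mul_cexp (t : E) :
    ∫ x : E, (stdGaussianPDF x : ℂ) * Complex.exp (inner ℝ x t * Complex.I) =
      Complex.exp (-‖t‖ ^ 2 / 2) := by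
  have hgauss := GaussianFourier.integral_cexp_neg_mul_sq_norm_add (V := E) (b := 1 / 2)
    (by norm_num) Complex.I t
  have hconst : (((2 * Real.pi) ^ (-(Module.finrank ℝ E : ℝ) / 2) : ℝ) : ℂ) *
      ((Real.pi : ℂ) / (1 / 2)) ^ ((Module.finrank ℝ E : ℂ) / 2) = 1 := by
    rw [show (Real.pi : ℂ) / (1 / 2) = ((2 * Real.pi : ℝ) : ℂ) by push_cast; ring,
      show (Module.finrank ℝ E : ℂ) / 2 = ((Module.finrank ℝ E / 2 : ℝ) : ℂ) by push_cast; ring,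
      ← Complex.ofReal_cpow (by positivity), ← Complex.ofReal_mul, ← Real.rpow_add (by positivity),
      neg_div, neg_add_cancel, Real.rpow_zero, Complex.ofReal_one]
  have hpt (x : E) : (stdGaussianPDF x : ℂ) * Complex.exp (inner ℝ x t * Complex.I) =
      (((2 * Real.pi) ^ (-(Module.finrank ℝ E : ℝ) / 2) : ℝ) : ℂ) *
        Complex.exp (-(1 / 2) * (‖x‖ : ℂ) ^ 2 + Complex.I * (inner ℝ t x : ℝ)) := by
    rw [stdGaussianPDF, Complex.exp_add, real_inner_comm]
    push_cast
    ring_nf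
  simp_rw [hpt]
  rw [integral_const_mul, hgauss, ← mul_assoc, hconst, one_mul]
  congr 1
  rw [Complex.I_sq]
  ring

theorem stdGaussian_eq_withDensity :
    stdGaussian E = volume.withDensity fun x => ENNReal.ofReal (stdGaussianPDF x) := by
  have : IsFiniteMeasure ((volume : Measure E).withDensity
      fun x => ENNReal.ofReal (stdGaussianPDF x)) :=
    isFiniteMeasure_withDensity_ofReal integrable_stdGaussianPDF.2
  refine Measure.ext_of_charFun (funext fun t => ?_)
  rw [charFun_stdGaussian, charFun_apply, integral_withDensity_eq_integral_toReal_smul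
    (by fun_prop) (by simp), ← integral_stdGaussianPDF_mul_cexp]
  simp only [ENNReal.toReal_ofReal (stdGaussianPDF_pos _).le, Complex.real_smul]

lemma integral_stdGaussian (f : E → ℝ) :
    ∫ x, f x ∂(stdGaussian E) = ∫ x : E, stdGaussianPDF x * f x := by
  rw [stdGaussian_eq_withDensity, integral_withDensity_eq_integral_toReal_smul
    (by fun_prop) (by simp)]
  simp only [ENNReal.toReal_ofReal (stdGaussianPDF_pos _).le, smul_eq_mul]

lemma integrable_stdGaussian_iff {f : E → ℝ} :
    Integrable f (stdGaussian E) ↔ Integrable fun x : E => stdGaussianPDF x * f x := by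
  rw [stdGaussian_eq_withDensity, integrable_withDensity_iff_integrable_smul' (by fun_prop)
    (by simp)]
  simp only [ENNReal.toReal_ofReal (stdGaussianPDF_pos _).le, smul_eq_mul]

lemma ae_ne_zero_stdGaussian [Nontrivial E] : ∀ᵐ x ∂(stdGaussian E), x ≠ 0 := by
  rw [stdGaussian_eq_withDensity]
  exact (withDensity_absolutelyContinuous _ _).ae_le (Measure.ae_ne volume 0)

lemma integrable_norm_rpow_stdGaussian [Nontrivial E] {s : ℝ}
    (hs : -(Module.finrank ℝ E : ℝ) < s) :
    Integrable (fun x : E => ‖x‖ ^ s) (stdGaussian E) := by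
  have hfinrank : 0 < Module.finrank ℝ E := Module.finrank_pos
  let c : ℝ := (2 * Real.pi) ^ (-(Module.finrank ℝ E : ℝ) / 2)
  have hpt : ∀ y ∈ Set.Ioi (0 : ℝ),
      y ^ (Module.finrank ℝ E - 1) • (c * Real.exp (-y ^ 2 / 2) * y ^ s) =
        c * (y ^ ((Module.finrank ℝ E : ℝ) - 1 + s) * Real.exp (-(1 / 2) * y ^ (2 : ℝ))) := by
    intro y hy
    rw [smul_eq_mul, ← Real.rpow_natCast, Nat.cast_sub hfinrank, Nat.cast_one, Real.rpow_add hy,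
      Real.rpow_two]
    ring_nf
  rw [integrable_stdGaussian_iff]
  refine (integrable_fun_norm_addHaar (μ := (volume : Measure E))
    (f := fun y => c * Real.exp (-y ^ 2 / 2) * y ^ s)).2 ?_
  rw [integrableOn_congr_fun hpt measurableSet_Ioi]
  exact (integrableOn_rpow_mul_exp_neg_mul_rpow (by linarith) two_pos (by norm_num)).const_mul _

lemma integral_gammaMeasure {a r : ℝ} (ha : 0 < a) (hr : 0 < r) (f : ℝ → ℝ) :
    ∫ t, f t ∂(gammaMeasure a r) = ∫ t in Set.Ioi 0, gammaPDFReal a r t * f t := by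
  have hzero : ∀ t ∉ Set.Ici (0 : ℝ), gammaPDFReal a r t * f t = 0 := fun t ht => by
    rw [gammaPDFReal, if_neg (by simpa using ht), zero_mul]
  have hpdf : Measurable (gammaPDF a r) := (measurable_gammaPDFReal a r).ennreal_ofReal
  rw [gammaMeasure, integral_withDensity_eq_integral_toReal_smul hpdf (by simp [gammaPDF]),
    ← integral_Ici_eq_integral_Ioi, setIntegral_eq_integral_of_forall_compl_eq_zero hzero]
  simp only [gammaPDF, ENNReal.toReal_ofReal (gammaPDFReal_nonneg ha hr _), smul_eq_mul]

lemma exists_integral_norm_sq_stdGaussian [Nontrivial E] : ∃ c : ℝ, ∀ f : ℝ → ℝ,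
    ∫ x, f (‖x‖ ^ 2) ∂(stdGaussian E) =
      c * ∫ t, f t ∂(gammaMeasure (Module.finrank ℝ E / 2) (1 / 2)) := by
  have hfinrank : 0 < Module.finrank ℝ E := Module.finrank_pos
  have ha : (0 : ℝ) < Module.finrank ℝ E / 2 := by positivity
  obtain ⟨N, hN⟩ : ∃ N : ℝ, N = Module.finrank ℝ E := ⟨_, rfl⟩
  obtain ⟨c, hc⟩ : ∃ c : ℝ, c = (2 * Real.pi) ^ (-(Module.finrank ℝ E : ℝ) / 2) := ⟨_, rfl⟩
  rw [← hN] at ha ⊢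
  let K : ℝ := (1 / 2) ^ (N / 2) / Real.Gamma (N / 2)
  have hK : 0 < K := div_pos (by positivity) (Real.Gamma_pos_of_pos ha)
  have hpt (f : ℝ → ℝ) : ∀ y ∈ Set.Ioi (0 : ℝ),
      y ^ (Module.finrank ℝ E - 1) • (c * Real.exp (-y ^ 2 / 2) * f (y ^ 2)) =
        (2 * y ^ ((2 : ℝ) - 1)) •
          (c / (2 * K) * (gammaPDFReal (N / 2) (1 / 2) (y ^ (2 : ℝ)) * f (y ^ (2 : ℝ)))) := by
    intro y hy
    have hpow : y ^ (Module.finrank ℝ E - 1) = y * (y ^ 2) ^ (N / 2 - 1) := by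
      rw [← Real.rpow_natCast, Nat.cast_sub hfinrank, ← hN, Nat.cast_one, ← Real.rpow_two,
        ← Real.rpow_mul (le_of_lt hy), show N - 1 = 1 + 2 * (N / 2 - 1) by ring,
        Real.rpow_add hy, Real.rpow_one]
    rw [gammaPDFReal, if_pos (Real.rpow_nonneg (le_of_lt hy) 2), hpow,
      show (2 : ℝ) - 1 = 1 by norm_num, Real.rpow_one, Real.rpow_two, smul_eq_mul, smul_eq_mul,
      show -(1 / 2 * y ^ 2) = -y ^ 2 / 2 by ring]
    change _ = 2 * y * (c / (2 * K) * (K * _ * _ * _))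
    field_simp
  refine ⟨Module.finrank ℝ E • (volume : Measure E).real (Metric.ball 0 1) * (c / (2 * K)),
    fun f => ?_⟩
  have hpolar := integral_fun_norm_addHaar (volume : Measure E)
    fun y => c * Real.exp (-y ^ 2 / 2) * f (y ^ 2)
  rw [setIntegral_congr_fun measurableSet_Ioi (hpt f),
    integral_comp_rpow_Ioi_of_pos
      (g := fun t => c / (2 * K) * (gammaPDFReal (N / 2) (1 / 2) t * f t)) two_pos,
    integral_const_mul, ← integral_gammaMeasure ha (by norm_num)] at hpolar
  rw [integral_stdGaussian, mul_assoc, nsmul_eq_mul, mul_assoc, ← nsmul_eq_mul,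
    ← smul_eq_mul (_ : ℝ), ← hpolar]
  simp only [stdGaussianPDF, hc]

theorem stdGaussian_map_norm_sq [Nontrivial E] :
    (stdGaussian E).map (fun x => ‖x‖ ^ 2) = gammaMeasure (Module.finrank ℝ E / 2) (1 / 2) := by
  have hfinrank : 0 < Module.finrank ℝ E := Module.finrank_pos
  have : IsProbabilityMeasure (gammaMeasure (Module.finrank ℝ E / 2) (1 / 2)) :=
    isProbabilityMeasure_gammaMeasure (by positivity) (by norm_num)
  obtain ⟨c, hc⟩ := exists_integral_norm_sq_stdGaussian (E := E)
  have hc1 : c = 1 := by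
    have h := hc fun _ => 1
    simp only [integral_const, probReal_univ, smul_eq_mul, mul_one] at h
    exact h.symm
  refine ext_of_forall_integral_eq_of_IsFiniteMeasure fun f => ?_
  rw [integral_map (by fun_prop) f.continuous.aestronglyMeasurable, hc f, hc1, one_mul]

theorem stdGaussian_prod {F : Type*} [NormedAddCommGroup F] [InnerProductSpace ℝ F]
    [FiniteDimensional ℝ F] [MeasurableSpace F] [BorelSpace F] :
    stdGaussian (WithLp 2 (E × F)) =
      ((stdGaussian E).prod (stdGaussian F)).map (WithLp.toLp 2) := by
  refine Measure.ext_of_charFun (funext fun t => ?_)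
  rw [charFun_prod, charFun_stdGaussian, charFun_stdGaussian, charFun_stdGaussian,
    ← Complex.exp_add, ← Complex.ofReal_pow, WithLp.prod_norm_sq_eq_of_L2 t]
  push_cast
  rw [← add_div, neg_add]
  rfl

lemma stdGaussian_eq_map_isometry_add {F : Type*} [NormedAddCommGroup F] [InnerProductSpace ℝ F]
    [FiniteDimensional ℝ F] [MeasurableSpace F] [BorelSpace F] (L : F →ₗᵢ[ℝ] E) :
    stdGaussian E = ((stdGaussian F).prod (stdGaussian L.toLinearMap.rangeᗮ)).map
      fun p => L p.1 + p.2 := by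
  let K := L.toLinearMap.range
  have hK : (stdGaussian F).map L.equivRange = stdGaussian K := stdGaussian_map L.equivRange
  have hprod := Measure.map_prod_map (stdGaussian F) (stdGaussian Kᗮ)
    L.equivRange.continuous.measurable measurable_id
  rw [hK, Measure.map_id] at hprod
  rw [← stdGaussian_map K.orthogonalDecomposition.symm, stdGaussian_prod, hprod,
    Measure.map_map (by fun_prop) (by fun_prop), Measure.map_map (by fun_prop) (by fun_prop)]
  rfl

theorem stdGaussian_map_adjoint {F : Type*} [NormedAddCommGroup F] [InnerProductSpace ℝ F]
    [FiniteDimensional ℝ F] [MeasurableSpace F] [BorelSpace F] (L : F →ₗᵢ[ℝ] E)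
    (hL : Module.finrank ℝ F < Module.finrank ℝ E) :
    (stdGaussian E).map (fun x => (L.toContinuousLinearMap.adjoint x,
        ‖x‖ ^ 2 - ‖L.toContinuousLinearMap.adjoint x‖ ^ 2)) =
      (stdGaussian F).prod
        (gammaMeasure ((Module.finrank ℝ E - Module.finrank ℝ F) / 2) (1 / 2)) := by
  let K := L.toLinearMap.range
  have hfinrank : Module.finrank ℝ F + Module.finrank ℝ Kᗮ = Module.finrank ℝ E := by
    rw [← K.finrank_add_finrank_orthogonal, LinearMap.finrank_range_of_inj L.injective]
  have : Nontrivial Kᗮ := Module.finrank_pos_iff.1 (by omega : 0 < Module.finrank ℝ Kᗮ)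
  have horthogonal (z : F) (y : Kᗮ) : inner ℝ (L z) (y : E) = 0 :=
    K.inner_right_of_mem_orthogonal (LinearMap.mem_range_self _ z) y.2
  have hadjoint (z : F) (y : Kᗮ) : L.toContinuousLinearMap.adjoint (L z + y) = z := by
    refine ext_inner_right ℝ fun z' => ?_
    rw [ContinuousLinearMap.adjoint_inner_left, L.coe_toContinuousLinearMap, inner_add_left,
      L.inner_map_map, real_inner_comm (L z') (y : E), horthogonal, add_zero]
  have hnorm (z : F) (y : Kᗮ) : ‖L z + y‖ ^ 2 - ‖z‖ ^ 2 = ‖y‖ ^ 2 := by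
    have h := norm_add_sq_eq_norm_sq_add_norm_sq_real (horthogonal z y)
    rw [L.norm_map] at h
    rw [sq, sq, sq, h, Submodule.coe_norm, add_sub_cancel_left]
  rw [stdGaussian_eq_map_isometry_add L, Measure.map_map (by fun_prop) (by fun_prop)]
  have hcomp : (fun x => (L.toContinuousLinearMap.adjoint x,
      ‖x‖ ^ 2 - ‖L.toContinuousLinearMap.adjoint x‖ ^ 2)) ∘
        (fun p : F × Kᗮ => L p.1 + p.2) = Prod.map id fun y => ‖y‖ ^ 2 := by
    funext p
    simp only [Function.comp_apply, hadjoint, hnorm, Prod.map, id]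
  rw [hcomp, ← Measure.map_prod_map _ _ measurable_id (by fun_prop), Measure.map_id,
    stdGaussian_map_norm_sq, ← hfinrank]
  push_cast
  rw [add_sub_cancel_left]

end Gaussian

section Conditioning

variable {R W : Type*} [MeasurableSpace R] {κ : Measure R}

/-- If `κ ⊗ μ` has density `D`, this is the law of the first coordinate conditioned on the second
one being `w₀`. -/
noncomputable def slice (κ : Measure R) (D : R × W → ℝ) (w₀ : W) : Measure R :=
  (ENNReal.ofReal (∫ r, D (r, w₀) ∂κ))⁻¹ • κ.withDensity fun r => ENNReal.ofReal (D (r, w₀))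

lemma isProbabilityMeasure_slice {D : R × W → ℝ} (hD0 : ∀ q, 0 ≤ D q) {w₀ : W}
    (hZ : 0 < ∫ r, D (r, w₀) ∂κ) : IsProbabilityMeasure (slice κ D w₀) where
  measure_univ := by
    rw [slice, Measure.smul_apply, withDensity_apply _ .univ, Measure.restrict_univ,
      ← ofReal_integral_eq_lintegral_ofReal (.of_integral_ne_zero hZ.ne')
        (Eventually.of_forall fun r => hD0 _), smul_eq_mul,
      ENNReal.inv_mul_cancel (by simpa using hZ) ENNReal.ofReal_ne_top]

lemma slice_absolutelyContinuous (D : R × W → ℝ) (w₀ : W) : slice κ D w₀ ≪ κ :=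
  (withDensity_absolutelyContinuous _ _).smul_left _

variable [MeasurableSpace W] {μ : Measure W}

lemma tendsto_setIntegral_div [TopologicalSpace W] [OpensMeasurableSpace W]
    [IsLocallyFiniteMeasure μ] {f : W → ℝ} (hf : StronglyMeasurable f) {w₀ : W}
    (hcont : ContinuousAt f w₀) {ι : Type*} {l : Filter ι} {s : ι → Set W}
    (hs : Tendsto s l (𝓝 w₀).smallSets) (hs0 : ∀ᶠ i in l, μ.real (s i) ≠ 0) :
    Tendsto (fun i => (∫ w in s i, f w ∂μ) / μ.real (s i)) l (𝓝 (f w₀)) := by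
  have hlittleO := (hcont.integral_sub_linear_isLittleO_ae (μ := μ)
    hf.stronglyMeasurableAtFilter hs).tendsto_div_nhds_zero
  rw [← tendsto_sub_nhds_zero_iff]
  refine hlittleO.congr' ?_
  filter_upwards [hs0] with i hi
  rw [smul_eq_mul, sub_div, mul_div_cancel_left₀ _ hi]

lemma setIntegral_withDensity_prod [SFinite κ] [SFinite μ] {D G : R × W → ℝ} (hD : Measurable D)
    (hD0 : ∀ q, 0 ≤ D q) {b : R → ℝ} (hb : Integrable b κ) (hDb : ∀ r w, D (r, w) ≤ b r)
    (hG : Measurable G) {C : ℝ} (hGC : ∀ q, ‖G q‖ ≤ C) {s : Set W} (hs : MeasurableSet s)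
    (hsμ : μ s ≠ ∞) :
    ∫ q in Set.univ ×ˢ s, G q ∂((κ.prod μ).withDensity fun q => ENNReal.ofReal (D q)) =
      ∫ w in s, ∫ r, D (r, w) * G (r, w) ∂κ ∂μ := by
  have : IsFiniteMeasure (μ.restrict s) := ⟨by simpa using hsμ.lt_top⟩
  have hint : Integrable (fun q => D q * G q) (κ.prod (μ.restrict s)) := by
    refine (hb.mul_prod (integrable_const C)).mono' (hD.mul hG).aestronglyMeasurable
      (Eventually.of_forall fun q => ?_)
    rw [norm_mul, Real.norm_of_nonneg (hD0 q)]
    exact mul_le_mul (hDb q.1 q.2) (hGC q) (norm_nonneg _) ((hD0 q).trans (hDb q.1 q.2))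
  rw [restrict_withDensity (MeasurableSet.univ.prod hs), ← Measure.prod_restrict,
    Measure.restrict_univ, integral_withDensity_eq_integral_toReal_smul hD.ennreal_ofReal
      (by simp), ← integral_prod_symm _ hint]
  simp only [ENNReal.toReal_ofReal (hD0 _), smul_eq_mul]

lemma continuousAt_integral_mul [TopologicalSpace W] [FirstCountableTopology W]
    {D G : R × W → ℝ} (hD : Measurable D)
    (hD0 : ∀ q, 0 ≤ D q) {b : R → ℝ} (hb : Integrable b κ) (hDb : ∀ r w, D (r, w) ≤ b r)
    (hG : Measurable G) {C : ℝ} (hGC : ∀ q, ‖G q‖ ≤ C) {w₀ : W}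
    (hDw : ∀ᵐ r ∂κ, ContinuousAt (fun w => D (r, w)) w₀)
    (hGw : ∀ᵐ r ∂κ, ContinuousAt (fun w => G (r, w)) w₀) :
    ContinuousAt (fun w => ∫ r, D (r, w) * G (r, w) ∂κ) w₀ := by
  refine continuousAt_of_dominated (Eventually.of_forall fun w => ?_)
    (Eventually.of_forall fun w => Eventually.of_forall fun r => ?_) (hb.mul_const C) ?_
  · exact ((hD.mul hG).comp (measurable_prodMk_right (y := w))).aestronglyMeasurable
  · rw [norm_mul, Real.norm_of_nonneg (hD0 _)]
    exact mul_le_mul (hDb r w) (hGC _) (norm_nonneg _) ((hD0 _).trans (hDb r w))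
  · filter_upwards [hDw, hGw] with r h h'
    exact h.mul h'

lemma integral_slice {D : R × W → ℝ} (hD : Measurable D) (hD0 : ∀ q, 0 ≤ D q) (w₀ : W)
    (f : R → ℝ) :
    ∫ r, f r ∂(slice κ D w₀) = (∫ r, D (r, w₀) * f r ∂κ) / ∫ r, D (r, w₀) ∂κ := by
  have hDm : Measurable fun r => ENNReal.ofReal (D (r, w₀)) :=
    (hD.comp measurable_prodMk_right).ennreal_ofReal
  rw [slice, integral_smul_measure, integral_withDensity_eq_integral_toReal_smul hDm (by simp),
    ENNReal.toReal_inv,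
    ENNReal.toReal_ofReal (integral_nonneg fun r => hD0 _), smul_eq_mul, div_eq_inv_mul]
  simp only [ENNReal.toReal_ofReal (hD0 _), smul_eq_mul]

theorem tendsto_integral_cond_slice [TopologicalSpace W] [OpensMeasurableSpace W]
    [FirstCountableTopology W] [IsLocallyFiniteMeasure μ] [SFinite κ] [SFinite μ]
    {P : Measure (R × W)} {D G : R × W → ℝ}
    (hP : P = (κ.prod μ).withDensity fun q => ENNReal.ofReal (D q))
    (hD : Measurable D) (hD0 : ∀ q, 0 ≤ D q) {b : R → ℝ} (hb : Integrable b κ)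
    (hDb : ∀ r w, D (r, w) ≤ b r) (hG : Measurable G) {C : ℝ} (hGC : ∀ q, ‖G q‖ ≤ C) {w₀ : W}
    (hZ : 0 < ∫ r, D (r, w₀) ∂κ) (hDw : ∀ᵐ r ∂κ, ContinuousAt (fun w => D (r, w)) w₀)
    (hGw : ∀ᵐ r ∂κ, ContinuousAt (fun w => G (r, w)) w₀) {ι : Type*} {l : Filter ι}
    {s : ι → Set W} (hs : Tendsto s l (𝓝 w₀).smallSets) (hs_meas : ∀ i, MeasurableSet (s i))
    (hs0 : ∀ᶠ i in l, μ (s i) ≠ 0) :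
    Tendsto (fun i => ∫ q, G q ∂P[|Set.univ ×ˢ s i]) l
      (𝓝 (∫ r, G (r, w₀) ∂(slice κ D w₀))) := by
  have hs_top : ∀ᶠ i in l, μ (s i) < ∞ := hs.eventually (μ.finiteAt_nhds w₀).eventually
  have hreal : ∀ᶠ i in l, μ.real (s i) ≠ 0 := by
    filter_upwards [hs0, hs_top] with i h0 htop using (measureReal_ne_zero_iff htop.ne).2 h0
  have hlim {H : R × W → ℝ} (hH : Measurable H) {B : ℝ} (hHB : ∀ q, ‖H q‖ ≤ B)
      (hHw : ∀ᵐ r ∂κ, ContinuousAt (fun w => H (r, w)) w₀) :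
      Tendsto (fun i => (∫ q in Set.univ ×ˢ s i, H q ∂P) / μ.real (s i)) l
        (𝓝 (∫ r, D (r, w₀) * H (r, w₀) ∂κ)) := by
    have hDH : Measurable fun p : W × R => D p.swap * H p.swap :=
      (hD.mul hH).comp measurable_swap
    have hmeas : StronglyMeasurable fun w => ∫ r, D (r, w) * H (r, w) ∂κ :=
      hDH.stronglyMeasurable.integral_prod_right
    refine (tendsto_setIntegral_div (μ := μ) hmeas
      (continuousAt_integral_mul hD hD0 hb hDb hH hHB hDw hHw)
      hs hreal).congr' ?_
    filter_upwards [hs_top] with i htop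
    rw [hP, setIntegral_withDensity_prod hD hD0 hb hDb hH hHB (hs_meas i) htop.ne]
  have hmass := hlim (H := fun _ => 1) measurable_const (fun _ => norm_one.le)
    (Eventually.of_forall fun _ => continuousAt_const)
  simp only [mul_one, setIntegral_const, smul_eq_mul] at hmass
  rw [integral_slice hD hD0]
  refine ((hlim hG hGC hGw).div hmass hZ.ne').congr' ?_
  filter_upwards [hreal] with i hi
  rw [Pi.div_apply, div_div_div_cancel_right₀ hi, ProbabilityTheory.cond, integral_smul_measure,
    ENNReal.toReal_inv, smul_eq_mul, div_eq_inv_mul]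
  rfl

end Conditioning

section GramCoordinates

variable {F : Type*} [NormedAddCommGroup F] [InnerProductSpace ℝ F]

/-- The vector `(2⟪u, v⟫, ‖u‖² - ‖v‖²)` in terms of `p = (⟪û, v⟫, ‖v‖² - ‖⟪û, v⟫‖²)`, where
`r = ‖u‖` and `u = r û`. -/
def ofGramCoord (r : ℝ) (p : F × ℝ) : F × ℝ := ((2 * r) • p.1, r ^ 2 - ‖p.1‖ ^ 2 - p.2)

/-- The inverse of `ofGramCoord r`. -/
noncomputable def gramCoord (r : ℝ) (w : F × ℝ) : F × ℝ :=
  ((2 * r)⁻¹ • w.1, r ^ 2 - ‖(2 * r)⁻¹ • w.1‖ ^ 2 - w.2)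

lemma gramCoord_ofGramCoord {r : ℝ} (hr : r ≠ 0) (p : F × ℝ) :
    gramCoord r (ofGramCoord r p) = p := by
  have hinv : (2 * r)⁻¹ • (2 * r) • p.1 = p.1 := inv_smul_smul₀ (by simpa using hr) p.1
  simp [gramCoord, ofGramCoord, hinv, -mul_inv_rev]

lemma gramCoord_zero (r : ℝ) : gramCoord r (0 : F × ℝ) = (0, r ^ 2) := by
  simp [gramCoord]

lemma continuous_gramCoord (r : ℝ) : Continuous (gramCoord r : F × ℝ → F × ℝ) := by
  unfold gramCoord
  fun_prop

/-- The density of `(2⟪u, v⟫, ‖u‖² - ‖v‖²)` given `‖u‖ = r`, as a function of `r` and of its value,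
when `(⟪û, v⟫, ‖v‖² - ‖⟪û, v⟫‖²)` has the standard Gaussian and the `Γ(a, 1/2)` distribution. -/
noncomputable def gramDensity (a : ℝ) (q : ℝ × F × ℝ) : ℝ :=
  |((2 * q.1) ^ Module.finrank ℝ F)⁻¹| *
    (stdGaussianPDF (gramCoord q.1 q.2).1 * gammaPDFReal a (1 / 2) (gramCoord q.1 q.2).2)

lemma gramDensity_nonneg {a : ℝ} (ha : 0 < a) (q : ℝ × F × ℝ) : 0 ≤ gramDensity a q :=
  mul_nonneg (abs_nonneg _) (mul_nonneg (stdGaussianPDF_pos _).le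
    (gammaPDFReal_nonneg ha (by norm_num) _))

variable [MeasurableSpace F] [BorelSpace F]

lemma measurable_ofGramCoord (r : ℝ) : Measurable (ofGramCoord r : F × ℝ → F × ℝ) := by
  unfold ofGramCoord
  fun_prop

variable [FiniteDimensional ℝ F]

lemma measurable_uncurry_gramCoord :
    Measurable fun q : ℝ × F × ℝ => gramCoord q.1 q.2 := by
  unfold gramCoord
  fun_prop

lemma volume_map_ofGramCoord {r : ℝ} (hr : r ≠ 0) :
    (volume : Measure (F × ℝ)).map (ofGramCoord r) =
      ENNReal.ofReal |((2 * r) ^ Module.finrank ℝ F)⁻¹| • volume := by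
  have hshear : MeasurePreserving (fun p : F × ℝ => (p.1, r ^ 2 - ‖p.1‖ ^ 2 - p.2))
      (volume.prod volume) (volume.prod volume) :=
    (MeasurePreserving.id volume).skew_product (g := fun z t => r ^ 2 - ‖z‖ ^ 2 - t)
      (by fun_prop) (Eventually.of_forall fun z =>
      (Measure.measurePreserving_sub_left volume (r ^ 2 - ‖z‖ ^ 2)).map_eq)
  have hcomp : (ofGramCoord r : F × ℝ → F × ℝ) =
      Prod.map ((2 * r) • ·) id ∘ fun p => (p.1, r ^ 2 - ‖p.1‖ ^ 2 - p.2) := rfl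
  rw [hcomp, ← Measure.map_map (by fun_prop) hshear.measurable, Measure.volume_eq_prod,
    hshear.map_eq, ← Measure.map_prod_map _ _ (by fun_prop) measurable_id,
    Measure.map_addHaar_smul _ (by simpa using hr), Measure.map_id, Measure.prod_smul_left]

lemma measurable_gramDensity (a : ℝ) : Measurable (gramDensity a : ℝ × F × ℝ → ℝ) := by
  have hgauss : Measurable (stdGaussianPDF : F → ℝ) := continuous_stdGaussianPDF.measurable
  have hgamma := measurable_gammaPDFReal a (1 / 2)
  have hcoord := measurable_uncurry_gramCoord (F := F)
  exact (by fun_prop : Measurable fun q : ℝ × F × ℝ => |((2 * q.1) ^ Module.finrank ℝ F)⁻¹|).mul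
    ((hgauss.comp hcoord.fst).mul (hgamma.comp hcoord.snd))

lemma stdGaussian_prod_gammaMeasure {a : ℝ} :
    (stdGaussian F).prod (gammaMeasure a (1 / 2)) = volume.withDensity
      fun p : F × ℝ => ENNReal.ofReal (stdGaussianPDF p.1 * gammaPDFReal a (1 / 2) p.2) := by
  rw [stdGaussian_eq_withDensity, gammaMeasure, prod_withDensity (by fun_prop)
    (show Measurable (gammaPDF a (1 / 2)) from
      (measurable_gammaPDFReal _ _).ennreal_ofReal), Measure.volume_eq_prod]
  congr with p
  rw [ENNReal.ofReal_mul (stdGaussianPDF_pos _).le]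
  rfl

theorem map_ofGramCoord_stdGaussian_prod {a r : ℝ} (hr : r ≠ 0) :
    ((stdGaussian F).prod (gammaMeasure a (1 / 2))).map (ofGramCoord r) =
      volume.withDensity fun w => ENNReal.ofReal (gramDensity a (r, w)) := by
  let g (p : F × ℝ) : ℝ≥0∞ := ENNReal.ofReal (stdGaussianPDF p.1 * gammaPDFReal a (1 / 2) p.2)
  have hg : Measurable g := ((continuous_stdGaussianPDF.measurable.comp measurable_fst).mul
    ((measurable_gammaPDFReal a (1 / 2)).comp measurable_snd)).ennreal_ofReal
  have hgT : Measurable fun w => g (gramCoord r w) := hg.comp (continuous_gramCoord r).measurable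
  have hleft : (fun w => g (gramCoord r w)) ∘ ofGramCoord r = g :=
    funext fun p => congrArg g (gramCoord_ofGramCoord hr p)
  have hlaw : (stdGaussian F).prod (gammaMeasure a (1 / 2)) = volume.withDensity g :=
    stdGaussian_prod_gammaMeasure
  rw [hlaw, ← hleft, ← withDensity_map (measurable_ofGramCoord r) hgT,
    volume_map_ofGramCoord hr, withDensity_smul_measure, ← withDensity_smul _ hgT]
  congr with w
  rw [gramDensity, ENNReal.ofReal_mul (abs_nonneg _)]
  rfl

end GramCoordinates

section GammaDensity

variable {a r : ℝ}

lemma gammaPDFReal_le (ha : 1 ≤ a) (hr : 0 < r) (x : ℝ) :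
    gammaPDFReal a r x ≤ r ^ a / Real.Gamma a * (a / r) ^ (a - 1) := by
  have ha0 : 0 < a := by linarith
  have : 0 ≤ r ^ a / Real.Gamma a := by positivity
  rcases lt_or_ge x 0 with hx | hx
  · rw [gammaPDFReal, if_neg hx.not_ge]
    positivity
  have hle : x ≤ a / r * Real.exp (r * x / a) := calc
    x = a / r * (r * x / a) := by field_simp
    _ ≤ a / r * Real.exp (r * x / a) := by
      gcongr
      linarith [Real.add_one_le_exp (r * x / a)]
  have hpow : x ^ (a - 1) ≤ (a / r) ^ (a - 1) * Real.exp (r * x) := calc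
    x ^ (a - 1) ≤ (a / r * Real.exp (r * x / a)) ^ (a - 1) :=
      Real.rpow_le_rpow hx hle (by linarith)
    _ = (a / r) ^ (a - 1) * Real.exp (r * x / a * (a - 1)) := by
      rw [Real.mul_rpow (by positivity) (Real.exp_pos _).le, ← Real.exp_mul]
    _ ≤ (a / r) ^ (a - 1) * Real.exp (r * x) := by
      refine mul_le_mul_of_nonneg_left (Real.exp_le_exp.2 ?_) (by positivity)
      rw [div_mul_eq_mul_div, div_le_iff₀ ha0]
      gcongr
      linarith
  rw [gammaPDFReal, if_pos hx, mul_assoc]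
  gcongr
  rwa [Real.exp_neg, ← div_eq_mul_inv, div_le_iff₀ (Real.exp_pos _)]

lemma continuousAt_gammaPDFReal {x : ℝ} (hx : 0 < x) : ContinuousAt (gammaPDFReal a r) x := by
  have hcont : ContinuousAt
      (fun y => r ^ a / Real.Gamma a * y ^ (a - 1) * Real.exp (-(r * y))) x := by
    have := Real.continuousAt_rpow_const x (a - 1) (Or.inl hx.ne')
    fun_prop
  refine hcont.congr ?_
  filter_upwards [lt_mem_nhds hx] with y hy
  rw [gammaPDFReal, if_pos hy.le]

end GammaDensity

section GramDensity

variable {F : Type*} [NormedAddCommGroup F] [InnerProductSpace ℝ F] {a : ℝ}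

lemma exists_gramDensity_le (ha : 1 ≤ a) : ∃ C : ℝ, ∀ q : ℝ × F × ℝ,
    gramDensity a q ≤ |((2 * q.1) ^ Module.finrank ℝ F)⁻¹| * C := by
  refine ⟨_, fun q => mul_le_mul_of_nonneg_left (mul_le_mul (stdGaussianPDF_le _)
    (gammaPDFReal_le ha one_half_pos _) ?_ (by positivity)) (abs_nonneg _)⟩
  exact gammaPDFReal_nonneg (by linarith) one_half_pos _

lemma gramDensity_zero_pos (ha : 0 < a) {r : ℝ} (hr : 0 < r) :
    0 < gramDensity a (r, (0 : F × ℝ)) := by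
  rw [gramDensity, gramCoord_zero]
  have hgamma := gammaPDFReal_pos ha one_half_pos (pow_pos hr 2)
  have hgauss := stdGaussianPDF_pos (0 : F)
  positivity

lemma continuousAt_gramDensity {r : ℝ} (hr : r ≠ 0) :
    ContinuousAt (fun w => gramDensity a (r, w)) (0 : F × ℝ) := by
  have hcoord := (continuous_gramCoord (F := F) r).continuousAt (x := 0)
  have hgamma : ContinuousAt (gammaPDFReal a (1 / 2)) (gramCoord r (0 : F × ℝ)).2 := by
    rw [gramCoord_zero]
    exact continuousAt_gammaPDFReal (by positivity)
  exact continuousAt_const.mul ((continuous_stdGaussianPDF.continuousAt.comp hcoord.fst).mul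
    (ContinuousAt.comp (f := fun w => (gramCoord r w).2) hgamma hcoord.snd))

lemma integrable_abs_inv_pow_map_norm_stdGaussian {E : Type*} [NormedAddCommGroup E]
    [InnerProductSpace ℝ E] [FiniteDimensional ℝ E] [MeasurableSpace E] [BorelSpace E]
    [Nontrivial E] {k : ℕ} (hk : k < Module.finrank ℝ E) :
    Integrable (fun r : ℝ => |((2 * r) ^ k)⁻¹|) ((stdGaussian E).map norm) := by
  rw [integrable_map_measure (by fun_prop) (by fun_prop)]
  have hpow := integrable_norm_rpow_stdGaussian (E := E) (s := -k) (by simpa using hk)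
  refine (hpow.const_mul ((2 ^ k)⁻¹)).congr (Eventually.of_forall fun x => ?_)
  simp [Real.rpow_neg, mul_pow, mul_comm, abs_of_nonneg]

end GramDensity

section ClosingVector

variable {𝕜 : Type} [RCLike 𝕜] {n : ℕ}

local notation "𝔼" => EuclideanSpace 𝕜 (Fin n)

lemma finrank_euclideanSpace_real : Module.finrank ℝ 𝔼 = n * Module.finrank ℝ 𝕜 := by
  rw [← Module.finrank_mul_finrank ℝ 𝕜 𝔼, finrank_euclideanSpace_fin, mul_comm]

/-- The sum of the edges of the polygon associated with a pair of vectors, in coordinates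
`𝕜 × ℝ`: this is the vector `(2⟪u, v⟫, ‖u‖² - ‖v‖²)`, which vanishes exactly when `u` and `v` are
orthogonal of equal length. -/
noncomputable def closingVector (x : 𝔼 × 𝔼) : 𝕜 × ℝ :=
  (2 * inner 𝕜 x.1 x.2, ‖x.1‖ ^ 2 - ‖x.2‖ ^ 2)

lemma continuous_closingVector : Continuous (closingVector : 𝔼 × 𝔼 → 𝕜 × ℝ) := by
  unfold closingVector
  fun_prop

lemma real_inner_eq_re (u v : 𝔼) : inner ℝ u v = RCLike.re (inner 𝕜 u v) := by
  simp only [PiLp.inner_apply, map_sum]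
  rfl

/-- The real-linear isometry `z ↦ z e` onto the `𝕜`-line through a unit vector `e`; its adjoint
is the `𝕜`-inner product with `e`. -/
noncomputable def lineIsometry {e : 𝔼} (he : ‖e‖ = 1) : 𝕜 →ₗᵢ[ℝ] 𝔼 where
  toLinearMap := (LinearMap.toSpanSingleton 𝕜 𝔼 e).restrictScalars ℝ
  norm_map' z := by simp [norm_smul, he]

lemma adjoint_lineIsometry {e : 𝔼} (he : ‖e‖ = 1) (v : 𝔼) :
    (lineIsometry he).toContinuousLinearMap.adjoint v = inner 𝕜 e v := by
  refine ext_inner_left ℝ fun z => ?_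
  calc inner ℝ z ((lineIsometry he).toContinuousLinearMap.adjoint v)
      = inner ℝ (z • e) v := ContinuousLinearMap.adjoint_inner_right _ z v
    _ = RCLike.re (inner 𝕜 e v * star z) := by
      rw [real_inner_eq_re, inner_smul_left, mul_comm, starRingEnd_apply]
    _ = inner ℝ z (inner 𝕜 e v) := rfl

lemma closingVector_eq_ofGramCoord {u : 𝔼} (hu : u ≠ 0) (v : 𝔼) :
    closingVector (u, v) = ofGramCoord ‖u‖ (inner 𝕜 ((‖u‖⁻¹ : 𝕜) • u) v,
      ‖v‖ ^ 2 - ‖inner 𝕜 ((‖u‖⁻¹ : 𝕜) • u) v‖ ^ 2) := by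
  have hu' : (‖u‖ : 𝕜) ≠ 0 := by simpa using hu
  simp only [closingVector, ofGramCoord, inner_smul_left, Prod.mk.injEq]
  refine ⟨?_, by ring⟩
  rw [RCLike.real_smul_eq_coe_mul]
  simp only [map_inv₀, RCLike.conj_ofReal]
  push_cast
  field_simp

variable (𝕜 n) in
/-- The shape parameter of the Gamma law of the squared distance from a standard Gaussian vector
of `𝕜ⁿ` to a fixed `𝕜`-line. -/
noncomputable def gramShape : ℝ := (Module.finrank ℝ 𝔼 - Module.finrank ℝ 𝕜) / 2

lemma stdGaussian_map_closingVector (hn : 2 ≤ n) {u : 𝔼} (hu : u ≠ 0) :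
    (stdGaussian 𝔼).map (fun v => closingVector (u, v)) =
      volume.withDensity fun w => ENNReal.ofReal (gramDensity (gramShape 𝕜 n) (‖u‖, w)) := by
  have he : ‖(‖u‖⁻¹ : 𝕜) • u‖ = 1 := by simp [norm_smul, hu]
  have hlt : Module.finrank ℝ 𝕜 < Module.finrank ℝ 𝔼 := by
    rw [finrank_euclideanSpace_real]
    exact lt_mul_left Module.finrank_pos hn
  rw [← map_ofGramCoord_stdGaussian_prod (norm_ne_zero_iff.2 hu), gramShape,
    ← stdGaussian_map_adjoint (lineIsometry he) hlt,
    Measure.map_map (measurable_ofGramCoord _) (by fun_prop)]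
  congr 1
  funext v
  rw [closingVector_eq_ofGramCoord hu, Function.comp_apply, adjoint_lineIsometry]

lemma stdGaussian_prod_map_norm_closingVector (hn : 2 ≤ n) :
    ((stdGaussian 𝔼).prod (stdGaussian 𝔼)).map (fun x => (‖x.1‖, closingVector x)) =
      (((stdGaussian 𝔼).map norm).prod volume).withDensity fun q =>
        ENNReal.ofReal (gramDensity (gramShape 𝕜 n) q) := by
  have : Nonempty (Fin n) := ⟨⟨0, by lia⟩⟩
  have hmeas : Measurable fun x : 𝔼 × 𝔼 => (‖x.1‖, closingVector x) :=
    (by fun_prop : Measurable fun x : 𝔼 × 𝔼 => ‖x.1‖).prodMk continuous_closingVector.measurable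
  have hD : Measurable fun q : ℝ × 𝕜 × ℝ => ENNReal.ofReal (gramDensity (gramShape 𝕜 n) q) :=
    (measurable_gramDensity _).ennreal_ofReal
  ext s hs
  have hind : Measurable (s.indicator fun q => ENNReal.ofReal (gramDensity (gramShape 𝕜 n) q)) :=
    hD.indicator hs
  rw [Measure.map_apply hmeas hs, Measure.prod_apply (hmeas hs), withDensity_apply _ hs,
    ← lintegral_indicator hs, lintegral_prod _ hind.aemeasurable,
    lintegral_map hind.lintegral_prod_right' measurable_norm]
  refine lintegral_congr_ae ?_
  filter_upwards [ae_ne_zero_stdGaussian] with u hu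
  calc stdGaussian 𝔼 ((fun v => closingVector (u, v)) ⁻¹' (Prod.mk ‖u‖ ⁻¹' s))
      = (stdGaussian 𝔼).map (fun v => closingVector (u, v)) (Prod.mk ‖u‖ ⁻¹' s) :=
        (Measure.map_apply (continuous_closingVector.measurable.comp measurable_prodMk_left)
          (measurable_prodMk_left hs)).symm
    _ = _ := by
      rw [stdGaussian_map_closingVector hn hu, withDensity_apply _ (measurable_prodMk_left hs),
        ← lintegral_indicator (measurable_prodMk_left hs)]
      rfl

end ClosingVector

section OrbitAverage

variable {G X : Type*} [Group G] [MulAction G X]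

lemma map_smul_cond [TopologicalSpace X] [ContinuousConstSMul G X] [MeasurableSpace X]
    [BorelSpace X] {μ : Measure X} {g : G} (hμ : μ.map (g • ·) = μ) {s : Set X}
    (hs : MeasurableSet s) (hgs : (g • ·) ⁻¹' s = s) : μ[|s].map (g • ·) = μ[|s] := by
  conv_rhs => rw [← hμ, cond_map (continuous_const_smul g).measurable hs, hgs]

variable [MeasurableSpace G] {η : Measure G}

/-- The average over the orbit of `x` of a function `h`, with respect to a measure on the group. -/
noncomputable def orbitAverage (η : Measure G) (h : X → ℝ) (x : X) : ℝ := ∫ g, h (g • x) ∂η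

lemma norm_orbitAverage_le [IsProbabilityMeasure η] {h : X → ℝ} {C : ℝ} (hC : ∀ x, ‖h x‖ ≤ C)
    (x : X) : ‖orbitAverage η h x‖ ≤ C := by
  simpa [orbitAverage] using norm_integral_le_of_norm_le_const (μ := η)
    (Eventually.of_forall fun g => hC (g • x))

lemma orbitAverage_smul [MeasurableMul G] [η.IsMulRightInvariant] (h : X → ℝ) (g : G) (x : X) :
    orbitAverage η h (g • x) = orbitAverage η h x := by
  simp only [orbitAverage, smul_smul]
  exact integral_mul_right_eq_self (fun g' => h (g' • x)) g

variable [TopologicalSpace G] [OpensMeasurableSpace G] [TopologicalSpace X] [ContinuousSMul G X]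
  [IsProbabilityMeasure η]

lemma continuous_orbitAverage [FirstCountableTopology X] (h : X →ᵇ ℝ) :
    Continuous (orbitAverage η h) :=
  continuous_of_dominated
    (fun _ => (h.continuous.comp (continuous_id.smul continuous_const)).aestronglyMeasurable)
    (fun x => Eventually.of_forall fun g => h.norm_coe_le_norm (g • x)) (integrable_const ‖h‖)
    (Eventually.of_forall fun g => h.continuous.comp (continuous_const_smul g))

lemma integral_orbitAverage [SecondCountableTopology X] [MeasurableSpace X] [BorelSpace X]
    {μ : Measure X} [IsFiniteMeasure μ] (hμ : ∀ g : G, μ.map (g • ·) = μ) (h : X →ᵇ ℝ) :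
    ∫ x, orbitAverage η h x ∂μ = ∫ x, h x ∂μ := by
  have hint : Integrable (fun p : X × G => h (p.2 • p.1)) (μ.prod η) :=
    .of_bound (h.continuous.comp (continuous_snd.smul continuous_fst)).aestronglyMeasurable ‖h‖
      (Eventually.of_forall fun p => h.norm_coe_le_norm _)
  have htranslate (g : G) : ∫ x, h (g • x) ∂μ = ∫ x, h x ∂μ := by
    rw [← integral_map (continuous_const_smul g).measurable.aemeasurable
      h.continuous.aestronglyMeasurable, hμ]
  simp only [orbitAverage]
  rw [integral_integral_swap hint]
  simp [htranslate]

end OrbitAverage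

section UnitaryAction

variable {𝕜 : Type} [RCLike 𝕜] {n : ℕ}

local notation "𝔼" => EuclideanSpace 𝕜 (Fin n)
local notation "𝕌" => Matrix.unitaryGroup (Fin n) 𝕜

/-- Unitary matrices act on vectors by matrix multiplication. -/
noncomputable instance : MulAction 𝕌 𝔼 where
  smul U v := WithLp.toLp 2 ((U : Matrix (Fin n) (Fin n) 𝕜).mulVec v.ofLp)
  one_smul v := congrArg (WithLp.toLp 2) (Matrix.one_mulVec v.ofLp)
  mul_smul _ _ _ := congrArg (WithLp.toLp 2) (Matrix.mulVec_mulVec ..).symm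

lemma unitary_smul_def (U : 𝕌) (v : 𝔼) :
    U • v = WithLp.toLp 2 ((U : Matrix (Fin n) (Fin n) 𝕜).mulVec v.ofLp) := rfl

lemma unitary_smul_single (U : 𝕌) (k : Fin n) :
    U • (EuclideanSpace.single k 1 : 𝔼) =
      WithLp.toLp 2 fun m => (U : Matrix (Fin n) (Fin n) 𝕜) m k := by
  ext m
  simp [unitary_smul_def]

instance : ContinuousSMul 𝕌 𝔼 where
  continuous_smul := (PiLp.continuous_toLp 2 _).comp
    ((continuous_subtype_val.comp continuous_fst).matrix_mulVec
      ((PiLp.continuous_ofLp 2 _).comp continuous_snd))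

instance : SMulCommClass ℝ 𝕌 𝔼 where
  smul_comm r U v := by simp [unitary_smul_def, Matrix.mulVec_smul]

/-- The action of a unitary matrix on vectors, as an isometry. -/
noncomputable def unitaryIsometry (U : 𝕌) : 𝔼 ≃ₗᵢ[𝕜] 𝔼 :=
  Unitary.linearIsometryEquiv ⟨Matrix.toEuclideanCLM (𝕜 := 𝕜) (U : Matrix (Fin n) (Fin n) 𝕜),
    Unitary.map_mem _ U.2⟩

lemma unitaryIsometry_apply (U : 𝕌) (v : 𝔼) : unitaryIsometry U v = U • v := rfl

lemma closingVector_smul (U : 𝕌) (x : 𝔼 × 𝔼) : closingVector (U • x) = closingVector x := by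
  simp [closingVector, ← unitaryIsometry_apply]

lemma stdGaussian_prod_map_smul (U : 𝕌) :
    ((stdGaussian 𝔼).prod (stdGaussian 𝔼)).map (U • ·) =
      (stdGaussian 𝔼).prod (stdGaussian 𝔼) := by
  have hfactor : (stdGaussian 𝔼).map (U • ·) = stdGaussian 𝔼 := by
    let L : 𝔼 ≃ₗᵢ[ℝ] 𝔼 :=
      ⟨(unitaryIsometry U).toLinearEquiv.restrictScalars ℝ, (unitaryIsometry U).norm_map⟩
    exact stdGaussian_map L
  have hU : Measurable fun v : 𝔼 => U • v := (continuous_const_smul U).measurable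
  nth_rw 3 [← hfactor]
  nth_rw 4 [← hfactor]
  exact (Measure.map_prod_map _ _ hU hU).symm

end UnitaryAction

section Frames

variable {𝕜 : Type} [RCLike 𝕜] {n : ℕ}

local notation "𝔼" => EuclideanSpace 𝕜 (Fin n)
local notation "𝕌" => Matrix.unitaryGroup (Fin n) 𝕜

variable (𝕜) in
/-- The pair formed by the first two vectors of the standard basis. -/
noncomputable def standardFrame (hn : 2 ≤ n) : 𝔼 × 𝔼 :=
  (EuclideanSpace.single (Fin.castLE hn 0) 1, EuclideanSpace.single (Fin.castLE hn 1) 1)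

lemma coe_frame (hn : 2 ≤ n) (U : 𝕌) : (frame 𝕜 hn U : 𝔼 × 𝔼) = U • standardFrame 𝕜 hn :=
  (Prod.ext (unitary_smul_single U _) (unitary_smul_single U _)).symm

lemma continuous_frame (hn : 2 ≤ n) : Continuous (frame 𝕜 hn) := by
  refine continuous_induced_rng.2 ?_
  exact (continuous_id.smul continuous_const).congr fun U => (coe_frame hn U).symm

lemma exists_unitary_smul_single_eq (b : OrthonormalBasis (Fin n) 𝕜 𝔼) :
    ∃ U : 𝕌, ∀ k, U • (EuclideanSpace.single k 1 : 𝔼) = b k := by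
  refine ⟨⟨_, (EuclideanSpace.basisFun (Fin n) 𝕜).toMatrix_orthonormalBasis_mem_unitary b⟩,
    fun k => ?_⟩
  rw [unitary_smul_single]
  ext m
  simp [Module.Basis.toMatrix_apply]

lemma frame_surjective (hn : 2 ≤ n) : Function.Surjective (frame 𝕜 hn) := by
  rintro ⟨⟨u, v⟩, hu, hv, huv⟩
  simp only at hu hv huv
  have hne : Fin.castLE hn 1 ≠ Fin.castLE hn 0 := by simp [Fin.ext_iff]
  let w (i : Fin n) : 𝔼 := if i = Fin.castLE hn 0 then u else v
  have hw0 : w (Fin.castLE hn 0) = u := if_pos rfl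
  have hw1 : w (Fin.castLE hn 1) = v := if_neg hne
  have horth : Orthonormal 𝕜
      (({Fin.castLE hn 0, Fin.castLE hn 1} : Set (Fin n)).domRestrict w) := by
    refine ⟨?_, ?_⟩
    · rintro ⟨i, rfl | rfl⟩
      · simpa [hw0] using hu
      · simpa [hw1] using hv
    · rintro ⟨i, rfl | rfl⟩ ⟨j, rfl | rfl⟩ hij
      · exact absurd rfl hij
      · simpa [hw0, hw1] using huv
      · simpa [hw0, hw1] using inner_eq_zero_symm.1 huv
      · exact absurd rfl hij
  obtain ⟨b, hb⟩ := horth.exists_orthonormalBasis_extension_of_card_eq (by simp)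
  obtain ⟨U, hU⟩ := exists_unitary_smul_single_eq b
  refine ⟨U, Subtype.ext ((coe_frame hn U).trans (Prod.ext ?_ ?_))⟩
  · exact (hU _).trans ((hb _ (by simp)).trans hw0)
  · exact (hU _).trans ((hb _ (by simp)).trans hw1)

variable {E : Type*} [NormedAddCommGroup E] [InnerProductSpace 𝕜 E]

lemma exists_norm_eq_one_and_inner_eq_zero (hE : 2 ≤ Module.finrank 𝕜 E) (e : E) :
    ∃ e' : E, ‖e'‖ = 1 ∧ inner 𝕜 e e' = 0 := by
  have hspan : Submodule.span 𝕜 {e} ≠ ⊤ := fun htop => by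
    have := finrank_span_le_card (R := 𝕜) ({e} : Set E)
    rw [htop, finrank_top] at this
    rw [Set.toFinset_singleton, Finset.card_singleton] at this
    lia
  obtain ⟨w, hw, hw0⟩ := Submodule.exists_mem_ne_zero_of_ne_bot
    (mt Submodule.orthogonal_eq_bot_iff.1 hspan)
  refine ⟨(‖w‖⁻¹ : 𝕜) • w, by simp [norm_smul, hw0], ?_⟩
  rw [inner_smul_right, Submodule.mem_orthogonal_singleton_iff_inner_right.1 hw, mul_zero]

lemma exists_orthogonal_decomposition (hE : 2 ≤ Module.finrank 𝕜 E) {e : E} (he : ‖e‖ = 1)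
    (v : E) : ∃ e' : E, ‖e'‖ = 1 ∧ inner 𝕜 e e' = 0 ∧
      v = inner 𝕜 e v • e + (√(‖v‖ ^ 2 - ‖inner 𝕜 e v‖ ^ 2) : 𝕜) • e' := by
  set w := v - inner 𝕜 e v • e with hw
  have hinner : inner 𝕜 e w = 0 := by
    simp [hw, inner_sub_right, inner_smul_right, inner_self_eq_norm_sq_to_K, he]
  have hnorm : √(‖v‖ ^ 2 - ‖inner 𝕜 e v‖ ^ 2) = ‖w‖ := by
    rw [← Real.sqrt_sq (norm_nonneg w), hw, norm_sub_sq (𝕜 := 𝕜), inner_smul_right,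
      inner_mul_symm_re_eq_norm, norm_mul, norm_inner_symm v e, norm_smul, he]
    ring_nf
  have hv : v = inner 𝕜 e v • e + w := (add_sub_cancel _ _).symm
  rw [hnorm]
  by_cases hw0 : w = 0
  · obtain ⟨e', he', hee'⟩ := exists_norm_eq_one_and_inner_eq_zero hE e
    exact ⟨e', he', hee', by simpa [hw0] using hv⟩
  · refine ⟨(‖w‖⁻¹ : 𝕜) • w, by simp [norm_smul, hw0], ?_, ?_⟩
    · rw [inner_smul_right, hinner, mul_zero]
    · rwa [smul_inv_smul₀ (by simpa using hw0)]

/-- A pair `(u, v)` with prescribed `‖u‖ = q.1` and closing vector `q.2`. -/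
noncomputable def gramPair (hn : 2 ≤ n) (q : ℝ × 𝕜 × ℝ) : 𝔼 × 𝔼 :=
  (q.1 • (standardFrame 𝕜 hn).1, (gramCoord q.1 q.2).1 • (standardFrame 𝕜 hn).1 +
    √(gramCoord q.1 q.2).2 • (standardFrame 𝕜 hn).2)

lemma gramPair_zero (hn : 2 ≤ n) {r : ℝ} (hr : 0 ≤ r) :
    gramPair hn (r, (0 : 𝕜 × ℝ)) = r • standardFrame 𝕜 hn := by
  simp [gramPair, gramCoord_zero, Real.sqrt_sq hr, Prod.smul_def]

lemma measurable_gramPair (hn : 2 ≤ n) :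
    Measurable (gramPair hn : ℝ × 𝕜 × ℝ → 𝔼 × 𝔼) := by
  have hcoord := measurable_uncurry_gramCoord (F := 𝕜)
  have : Measurable fun q : ℝ × 𝕜 × ℝ => (gramCoord q.1 q.2).1 := hcoord.fst
  have : Measurable fun q : ℝ × 𝕜 × ℝ => (gramCoord q.1 q.2).2 := hcoord.snd
  unfold gramPair
  fun_prop

lemma continuous_gramPair (hn : 2 ≤ n) (r : ℝ) :
    Continuous fun w : 𝕜 × ℝ => gramPair hn (r, w) := by
  have : Continuous (gramCoord r : 𝕜 × ℝ → 𝕜 × ℝ) := continuous_gramCoord r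
  simp only [gramPair]
  fun_prop

lemma exists_unitary_smul_gramPair (hn : 2 ≤ n) {x : 𝔼 × 𝔼} (hx : x.1 ≠ 0) :
    ∃ U : 𝕌, x = U • gramPair hn (‖x.1‖, closingVector x) := by
  have he : ‖(‖x.1‖⁻¹ : 𝕜) • x.1‖ = 1 := by simp [norm_smul, hx]
  obtain ⟨e', he', hee', hdecomp⟩ :=
    exists_orthogonal_decomposition (𝕜 := 𝕜) (by simpa using hn) he x.2
  obtain ⟨U, hU⟩ := frame_surjective hn ⟨(_, e'), he, he', hee'⟩
  have hframe : U • standardFrame 𝕜 hn = ((‖x.1‖⁻¹ : 𝕜) • x.1, e') := by rw [← coe_frame, hU]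
  have hfst : U • (standardFrame 𝕜 hn).1 = (‖x.1‖⁻¹ : 𝕜) • x.1 := congrArg Prod.fst hframe
  have hsnd : U • (standardFrame 𝕜 hn).2 = e' := congrArg Prod.snd hframe
  have hcoord : gramCoord ‖x.1‖ (closingVector x) = _ :=
    (congrArg _ (closingVector_eq_ofGramCoord hx x.2)).trans
      (gramCoord_ofGramCoord (norm_ne_zero_iff.2 hx) _)
  rw [← unitaryIsometry_apply] at hfst hsnd
  refine ⟨U, Prod.ext ?_ ?_⟩
  · simp only [gramPair, Prod.smul_mk, ← unitaryIsometry_apply,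
      RCLike.real_smul_eq_coe_smul (K := 𝕜), map_smul, hfst]
    rw [smul_inv_smul₀ (by simpa using hx)]
  · simp only [gramPair, Prod.smul_mk, ← unitaryIsometry_apply,
      RCLike.real_smul_eq_coe_smul (K := 𝕜), map_smul, map_add, hfst, hsnd, hcoord]
    exact hdecomp

end Frames

section UnitaryHaar

variable (𝕜 : Type) [RCLike 𝕜] (n : ℕ)

/-- The Haar probability measure on the unitary (orthogonal) group. -/
noncomputable abbrev unitaryHaar : Measure (Matrix.unitaryGroup (Fin n) 𝕜) :=
  Measure.haarMeasure ⊤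

instance : IsProbabilityMeasure (unitaryHaar 𝕜 n) := ⟨Measure.haarMeasure_self (K₀ := ⊤)⟩

instance : (unitaryHaar 𝕜 n).IsMulRightInvariant where
  map_mul_right_eq_self g := by
    have hhaar : ((unitaryHaar 𝕜 n).map (· * g)).IsHaarMeasure :=
      inferInstanceAs ((unitaryHaar 𝕜 n).map (MulOpposite.op g • ·)).IsHaarMeasure
    have hprob : IsProbabilityMeasure ((unitaryHaar 𝕜 n).map (· * g)) :=
      Measure.isProbabilityMeasure_map (by fun_prop)
    exact Measure.isHaarMeasure_eq_of_isProbabilityMeasure _ _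

end UnitaryHaar

section GaussianPairs

variable {𝕜 : Type} [RCLike 𝕜] {n : ℕ}

local notation "𝔼" => EuclideanSpace 𝕜 (Fin n)
local notation "𝕌" => Matrix.unitaryGroup (Fin n) 𝕜

lemma integral_cond_closingVector (hn : 2 ≤ n) (h : 𝔼 × 𝔼 →ᵇ ℝ) {s : Set (𝕜 × ℝ)}
    (hs : MeasurableSet s) :
    ∫ x, h x ∂((stdGaussian 𝔼).prod (stdGaussian 𝔼))[|closingVector ⁻¹' s] =
      ∫ q, orbitAverage (unitaryHaar 𝕜 n) h (gramPair hn q) ∂(((stdGaussian 𝔼).prod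
        (stdGaussian 𝔼)).map fun x => (‖x.1‖, closingVector x))[|Set.univ ×ˢ s] := by
  have : Nonempty (Fin n) := ⟨⟨0, by lia⟩⟩
  set γ := (stdGaussian 𝔼).prod (stdGaussian 𝔼)
  have hclosing : Measurable (closingVector : 𝔼 × 𝔼 → 𝕜 × ℝ) :=
    continuous_closingVector.measurable
  have hq : Measurable fun x : 𝔼 × 𝔼 => (‖x.1‖, closingVector x) :=
    measurable_fst.norm.prodMk hclosing
  have hpre : (fun x : 𝔼 × 𝔼 => (‖x.1‖, closingVector x)) ⁻¹' (Set.univ ×ˢ s) =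
      closingVector ⁻¹' s := by
    ext x
    simp
  have hinv (U : 𝕌) : γ[|closingVector ⁻¹' s].map (U • ·) = γ[|closingVector ⁻¹' s] :=
    map_smul_cond (stdGaussian_prod_map_smul U) (hclosing hs) (by ext x; simp [closingVector_smul])
  have hgram : Measurable fun q => orbitAverage (unitaryHaar 𝕜 n) h (gramPair hn q) :=
    (continuous_orbitAverage h).measurable.comp (measurable_gramPair hn)
  rw [cond_map hq (MeasurableSet.univ.prod hs), hpre,
    integral_map hq.aemeasurable hgram.aestronglyMeasurable,
    ← integral_orbitAverage (η := unitaryHaar 𝕜 n) hinv h]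
  refine integral_congr_ae (cond_absolutelyContinuous.ae_le ?_)
  have hne : ∀ᵐ x ∂γ, x.1 ≠ 0 := Measure.quasiMeasurePreserving_fst.ae ae_ne_zero_stdGaussian
  filter_upwards [hne] with x hx
  obtain ⟨U, hU⟩ := exists_unitary_smul_gramPair hn hx
  exact (congrArg _ hU).trans (orbitAverage_smul _ _ _)

variable (𝕜 n) in
/-- The law of the common norm of the two vectors of a standard Gaussian pair, conditioned on the
closing vector being zero. -/
noncomputable def closedRadius : Measure ℝ :=
  slice ((stdGaussian 𝔼).map norm) (gramDensity (gramShape 𝕜 n)) (0 : 𝕜 × ℝ)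

lemma ae_pos_map_norm_stdGaussian [Nonempty (Fin n)] :
    ∀ᵐ r ∂((stdGaussian 𝔼).map norm), 0 < r := by
  rw [ae_map_iff measurable_norm.aemeasurable measurableSet_Ioi]
  filter_upwards [ae_ne_zero_stdGaussian] with x hx using norm_pos_iff.2 hx

lemma ae_pos_closedRadius [Nonempty (Fin n)] : ∀ᵐ r ∂(closedRadius 𝕜 n), 0 < r :=
  (slice_absolutelyContinuous _ _).ae_le ae_pos_map_norm_stdGaussian

lemma one_le_gramShape (hdim : Module.finrank ℝ 𝕜 + 1 < n * Module.finrank ℝ 𝕜) :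
    1 ≤ gramShape 𝕜 n := by
  have : (Module.finrank ℝ 𝕜 + 2 : ℝ) ≤ n * Module.finrank ℝ 𝕜 := by exact_mod_cast hdim
  rw [gramShape, finrank_euclideanSpace_real]
  push_cast
  linarith

lemma exists_gramDensity_bound [Nonempty (Fin n)]
    (hdim : Module.finrank ℝ 𝕜 + 1 < n * Module.finrank ℝ 𝕜) :
    ∃ b : ℝ → ℝ, Integrable b ((stdGaussian 𝔼).map norm) ∧
      ∀ r (w : 𝕜 × ℝ), gramDensity (gramShape 𝕜 n) (r, w) ≤ b r := by
  have hlt : Module.finrank ℝ 𝕜 < Module.finrank ℝ 𝔼 := by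
    rw [finrank_euclideanSpace_real]
    lia
  obtain ⟨C, hC⟩ := exists_gramDensity_le (F := 𝕜) (one_le_gramShape hdim)
  exact ⟨_, (integrable_abs_inv_pow_map_norm_stdGaussian hlt).mul_const C, fun r w => hC (r, w)⟩

lemma integral_gramDensity_zero_pos [Nonempty (Fin n)]
    (hdim : Module.finrank ℝ 𝕜 + 1 < n * Module.finrank ℝ 𝕜) :
    0 < ∫ r, gramDensity (gramShape 𝕜 n) (r, (0 : 𝕜 × ℝ)) ∂((stdGaussian 𝔼).map norm) := by
  have hshape : 0 < gramShape 𝕜 n := zero_lt_one.trans_le (one_le_gramShape hdim)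
  have : IsProbabilityMeasure ((stdGaussian 𝔼).map norm) :=
    Measure.isProbabilityMeasure_map (by fun_prop)
  have hmeas : Measurable fun r => gramDensity (gramShape 𝕜 n) (r, (0 : 𝕜 × ℝ)) :=
    (measurable_gramDensity _).comp measurable_prodMk_right
  obtain ⟨b, hb, hle⟩ := exists_gramDensity_bound hdim
  have hint : Integrable (fun r => gramDensity (gramShape 𝕜 n) (r, (0 : 𝕜 × ℝ)))
      ((stdGaussian 𝔼).map norm) :=
    hb.mono' hmeas.aestronglyMeasurable (Eventually.of_forall fun r => by
      rw [Real.norm_of_nonneg (gramDensity_nonneg hshape _)]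
      exact hle r 0)
  refine (integral_nonneg fun r => gramDensity_nonneg hshape _).lt_of_ne' fun hzero => ?_
  have hae := (integral_eq_zero_iff_of_nonneg (fun r => gramDensity_nonneg hshape _) hint).1 hzero
  obtain ⟨r, hr0, hr⟩ := (hae.and ae_pos_map_norm_stdGaussian).exists
  exact (gramDensity_zero_pos hshape hr).ne' hr0

lemma isProbabilityMeasure_closedRadius [Nonempty (Fin n)]
    (hdim : Module.finrank ℝ 𝕜 + 1 < n * Module.finrank ℝ 𝕜) :
    IsProbabilityMeasure (closedRadius 𝕜 n) :=
  isProbabilityMeasure_slice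
    (fun _ => gramDensity_nonneg (zero_lt_one.trans_le (one_le_gramShape hdim)) _)
    (integral_gramDensity_zero_pos hdim)

lemma orbitAverage_gramPair_zero (hn : 2 ≤ n) (h : 𝔼 × 𝔼 → ℝ) {r : ℝ} (hr : 0 ≤ r) :
    orbitAverage (unitaryHaar 𝕜 n) h (gramPair hn (r, 0)) =
      ∫ U, h (r • frame 𝕜 hn U) ∂(unitaryHaar 𝕜 n) := by
  simp only [orbitAverage, gramPair_zero hn hr, coe_frame, smul_comm _ r]

theorem tendsto_integral_cond_closingVector (hn : 2 ≤ n)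
    (hdim : Module.finrank ℝ 𝕜 + 1 < n * Module.finrank ℝ 𝕜) (h : 𝔼 × 𝔼 →ᵇ ℝ)
    {ι : Type*} {l : Filter ι} {s : ι → Set (𝕜 × ℝ)} (hs : Tendsto s l (𝓝 0).smallSets)
    (hs_meas : ∀ i, MeasurableSet (s i)) (hs0 : ∀ᶠ i in l, volume (s i) ≠ 0) :
    Tendsto (fun i => ∫ x, h x ∂((stdGaussian 𝔼).prod (stdGaussian 𝔼))[|closingVector ⁻¹' s i])
      l (𝓝 (∫ r, ∫ U, h (r • frame 𝕜 hn U) ∂(unitaryHaar 𝕜 n) ∂(closedRadius 𝕜 n))) := by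
  have : Nonempty (Fin n) := ⟨⟨0, by lia⟩⟩
  have hshape : 0 < gramShape 𝕜 n := zero_lt_one.trans_le (one_le_gramShape hdim)
  have hcont := continuous_orbitAverage (η := unitaryHaar 𝕜 n) h
  obtain ⟨b, hb, hle⟩ := exists_gramDensity_bound hdim
  have hlim := tendsto_integral_cond_slice (stdGaussian_prod_map_norm_closingVector hn)
    (measurable_gramDensity _) (gramDensity_nonneg hshape) hb hle
    (hcont.measurable.comp (measurable_gramPair hn))
    (fun q => norm_orbitAverage_le h.norm_coe_le_norm _) (integral_gramDensity_zero_pos hdim)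
    (ae_pos_map_norm_stdGaussian.mono fun r hr => continuousAt_gramDensity hr.ne')
    (Eventually.of_forall fun r => (hcont.comp (continuous_gramPair hn r)).continuousAt)
    hs hs_meas hs0
  have hvalue : ∫ r, orbitAverage (unitaryHaar 𝕜 n) h (gramPair hn (r, 0)) ∂(closedRadius 𝕜 n) =
      ∫ r, ∫ U, h (r • frame 𝕜 hn U) ∂(unitaryHaar 𝕜 n) ∂(closedRadius 𝕜 n) :=
    integral_congr_ae (ae_pos_closedRadius.mono fun r hr =>
      orbitAverage_gramPair_zero hn h hr.le)
  simp_rw [integral_cond_closingVector hn h (hs_meas _)]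
  exact hvalue ▸ hlim

end GaussianPairs

section RandomDilation

variable {V : Type*} [AddCommGroup V] [Module ℝ V] [MeasurableSpace V] [MeasurableSMul₂ ℝ V]
  {S : Set V} {σ : Measure S} {τ : Measure ℝ}

/-- The law of `t • x`, where `x` and `t` are independent with laws `σ` and `τ`. -/
noncomputable def randomDilation (σ : Measure S) (τ : Measure ℝ) : Measure V :=
  (σ.prod τ).map fun p => p.2 • (p.1 : V)

lemma measurable_smul_coe : Measurable fun p : S × ℝ => p.2 • (p.1 : V) :=
  measurable_snd.smul (measurable_subtype_coe.comp measurable_fst)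

lemma isProbabilityMeasure_randomDilation [IsProbabilityMeasure σ] [IsProbabilityMeasure τ] :
    IsProbabilityMeasure (randomDilation σ τ) :=
  Measure.isProbabilityMeasure_map measurable_smul_coe.aemeasurable

lemma randomDilation_map {α β : Type*} [MeasurableSpace α] [MeasurableSpace β] {η : Measure α}
    {ρ : Measure β} [SFinite η] [SFinite ρ] {φ : α → S} (hφ : Measurable φ) {g : β → ℝ}
    (hg : Measurable g) : randomDilation (η.map φ) (ρ.map g) =
      (η.prod ρ).map fun p => g p.2 • (φ p.1 : V) := by
  rw [randomDilation, Measure.map_prod_map _ _ hφ hg,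
    Measure.map_map measurable_smul_coe (hφ.prodMap hg)]
  rfl

variable {len : V → ℝ} {c : ℝ}

lemma ae_pos_randomDilation (hτ : ∀ᵐ t ∂τ, 0 < t) (hlen : Measurable len)
    (hsmul : ∀ t : ℝ, 0 < t → ∀ x, len (t • x) = t * len x) (hc : 0 < c)
    (hS : ∀ x ∈ S, len x = c) : ∀ᵐ x ∂(randomDilation σ τ), 0 < len x := by
  rw [randomDilation, ae_map_iff measurable_smul_coe.aemeasurable
    (measurableSet_lt measurable_const hlen)]
  filter_upwards [Measure.quasiMeasurePreserving_snd.ae hτ] with p hp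
  rw [hsmul _ hp, hS _ p.1.2]
  positivity

variable [IsProbabilityMeasure τ]

lemma randomDilation_map_normalize (hτ : ∀ᵐ t ∂τ, 0 < t) (hlen : Measurable len)
    (hsmul : ∀ t : ℝ, 0 < t → ∀ x, len (t • x) = t * len x) (hc : 0 < c)
    (hS : ∀ x ∈ S, len x = c) :
    (randomDilation σ τ).map (fun x => (c / len x) • x) = σ.map Subtype.val := by
  have hae : (fun x => (c / len x) • x) ∘ (fun p : S × ℝ => p.2 • (p.1 : V)) =ᵐ[σ.prod τ]
      Subtype.val ∘ Prod.fst := by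
    filter_upwards [Measure.quasiMeasurePreserving_snd.ae hτ] with p hp
    rw [Function.comp_apply, hsmul _ hp, hS _ p.1.2, smul_smul,
      show c / (p.2 * c) * p.2 = 1 by field_simp, one_smul, Function.comp_apply]
  have hN : Measurable fun x => (c / len x) • x := (measurable_const.div hlen).smul measurable_id
  rw [randomDilation, Measure.map_map hN measurable_smul_coe, Measure.map_congr hae,
    ← Measure.map_map measurable_subtype_coe measurable_fst, Measure.map_fst_prod, measure_univ,
    one_smul]

variable [SFinite σ]

lemma ScaleInvariant.integrable_of_randomDilation {F : V → ℝ} (hF : ScaleInvariant F)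
    (hτ : ∀ᵐ t ∂τ, 0 < t) (h : Integrable F (randomDilation σ τ)) :
    Integrable (fun x : S => F x) σ := by
  have hprod : Integrable (fun p : S × ℝ => F p.1) (σ.prod τ) := by
    refine (h.comp_measurable measurable_smul_coe).congr ?_
    filter_upwards [Measure.quasiMeasurePreserving_snd.ae hτ] with p hp using hF _ hp _
  exact hprod.prod_left_ae.exists.choose_spec

theorem ScaleInvariant.integrable_and_integral_randomDilation {F : V → ℝ} (hF : ScaleInvariant F)
    (hSm : MeasurableSet S) (hτ : ∀ᵐ t ∂τ, 0 < t) (hlen : Measurable len)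
    (hsmul : ∀ t : ℝ, 0 < t → ∀ x, len (t • x) = t * len x) (hc : 0 < c)
    (hS : ∀ x ∈ S, len x = c) :
    (Integrable F (randomDilation σ τ) ↔ Integrable (fun x : S => F x) σ) ∧
      ∫ x, F x ∂(randomDilation σ τ) = ∫ x : S, F x ∂σ := by
  have hval := MeasurableEmbedding.subtype_coe hSm
  have hN : Measurable fun x => (c / len x) • x := (measurable_const.div hlen).smul measurable_id
  have hFN : (fun x => F ((c / len x) • x)) =ᵐ[randomDilation σ τ] F := by
    filter_upwards [ae_pos_randomDilation hτ hlen hsmul hc hS] with x hx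
    exact hF _ (div_pos hc hx) x
  have hmap := randomDilation_map_normalize (σ := σ) hτ hlen hsmul hc hS
  have hint (h : Integrable (fun x : S => F x) σ) :
      Integrable F ((randomDilation σ τ).map fun x => (c / len x) • x) := by
    rw [hmap]
    exact hval.integrable_map_iff.2 h
  refine ⟨⟨hF.integrable_of_randomDilation hτ,
    fun h => ((hint h).comp_measurable hN).congr hFN⟩, ?_⟩
  by_cases h : Integrable (fun x : S => F x) σ
  · rw [← integral_congr_ae hFN, ← integral_map hN.aemeasurable (hint h).aestronglyMeasurable, hmap,
      hval.integral_map]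
  · rw [integral_undef h, integral_undef fun h' => h (hF.integrable_of_randomDilation hτ h')]

end RandomDilation

section Polygons

variable {d n : ℕ}

lemma measurableEmbedding_coe_polygons (d n : ℕ) :
    MeasurableEmbedding ((↑) : Polygons d n → Arms d n) :=
  MeasurableEmbedding.subtype_coe (Polygons d n).closed_of_finiteDimensional.measurableSet

theorem IsSubspaceMeasure.unique {μ : Measure (Arms d n)} {ν ν' : Measure (Polygons d n)}
    (h : IsSubspaceMeasure μ ν) (h' : IsSubspaceMeasure μ ν') : ν = ν' := by
  have := h.1
  have := h'.1
  have hcoe := measurableEmbedding_coe_polygons d n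
  have := Measure.isProbabilityMeasure_map (μ := ν) hcoe.measurable.aemeasurable
  have := Measure.isProbabilityMeasure_map (μ := ν') hcoe.measurable.aemeasurable
  have hmap : ν.map ((↑) : Polygons d n → Arms d n) = ν'.map ((↑) : Polygons d n → Arms d n) := by
    refine ext_of_forall_integral_eq_of_IsFiniteMeasure fun f => ?_
    rw [hcoe.integral_map, hcoe.integral_map]
    exact tendsto_nhds_unique (h.2 f) (h'.2 f)
  rw [← hcoe.comap_map ν, hmap, hcoe.comap_map]

theorem IsSubspaceMeasure.subspaceMeasure_eq {μ : Measure (Arms d n)}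
    {ν : Measure (Polygons d n)} (h : IsSubspaceMeasure μ ν) : subspaceMeasure μ = ν := by
  have hex : ∃ ν : Measure (Polygons d n), IsSubspaceMeasure μ ν := ⟨ν, h⟩
  rw [subspaceMeasure, dif_pos hex]
  exact hex.choose_spec.unique h

/-- The total length of a polygon. -/
noncomputable def totalLength (e : Arms d n) : ℝ := ∑ i, ‖e i‖

lemma continuous_totalLength : Continuous (totalLength : Arms d n → ℝ) := by
  unfold totalLength
  fun_prop

lemma totalLength_smul {t : ℝ} (ht : 0 < t) (e : Arms d n) :
    totalLength (t • e) = t * totalLength e := by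
  simp [totalLength, norm_smul, Finset.mul_sum, abs_of_pos ht]

lemma ScaleInvariant.integrable_and_integral_arm {F : Arms d n → ℝ} (hF : ScaleInvariant F)
    {σ : Measure (Arm d n)} [SFinite σ] {τ : Measure ℝ} [IsProbabilityMeasure τ]
    (hτ : ∀ᵐ t ∂τ, 0 < t) :
    (Integrable F (randomDilation σ τ) ↔ Integrable (fun e : Arm d n => F e) σ) ∧
      ∫ e, F e ∂(randomDilation σ τ) = ∫ e : Arm d n, F e ∂σ :=
  hF.integrable_and_integral_randomDilation
    (isClosed_eq continuous_totalLength continuous_const).measurableSet hτ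
    continuous_totalLength.measurable (fun _ ht => totalLength_smul ht) two_pos fun _ he => he

lemma ScaleInvariant.integrable_and_integral_pol {F : Polygons d n → ℝ} (hF : ScaleInvariant F)
    {σ : Measure (Pol d n)} [SFinite σ] {τ : Measure ℝ} [IsProbabilityMeasure τ]
    (hτ : ∀ᵐ t ∂τ, 0 < t) :
    (Integrable F (randomDilation σ τ) ↔ Integrable (fun p : Pol d n => F p) σ) ∧
      ∫ p, F p ∂(randomDilation σ τ) = ∫ p : Pol d n, F p ∂σ :=
  have hlen : Continuous fun p : Polygons d n => totalLength (p : Arms d n) :=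
    continuous_totalLength.comp continuous_subtype_val
  hF.integrable_and_integral_randomDilation (isClosed_eq hlen continuous_const).measurableSet hτ
    hlen.measurable (fun _ ht p => totalLength_smul ht (p : Arms d n)) two_pos fun _ hp => hp

end Polygons

section ClosedPolygons

variable {𝕜 : Type} [RCLike 𝕜] {d n : ℕ}

local notation "𝔼" => EuclideanSpace 𝕜 (Fin n)

lemma tendsto_l2Ball_smallSets :
    Tendsto (fun ε => {w : 𝕜 × ℝ | ‖WithLp.toLp 2 w‖ < ε}) (𝓝[>] 0) (𝓝 0).smallSets := by
  refine tendsto_smallSets_iff.2 fun t ht => ?_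
  have hcont : Tendsto (WithLp.ofLp : WithLp 2 (𝕜 × ℝ) → 𝕜 × ℝ) (𝓝 0) (𝓝 0) :=
    (WithLp.prod_continuous_ofLp 2 𝕜 ℝ).tendsto 0
  obtain ⟨δ, hδ, hball⟩ := Metric.mem_nhds_iff.1 (hcont ht)
  filter_upwards [Ioo_mem_nhdsGT hδ] with ε hε w hw
  exact hball (mem_ball_zero_iff.2 (hw.trans hε.2))

lemma isOpen_l2Ball (ε : ℝ) : IsOpen {w : 𝕜 × ℝ | ‖WithLp.toLp 2 w‖ < ε} :=
  isOpen_lt (WithLp.prod_continuous_toLp 2 𝕜 ℝ).norm continuous_const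

lemma volume_l2Ball_ne_zero {ε : ℝ} (hε : 0 < ε) :
    volume {w : 𝕜 × ℝ | ‖WithLp.toLp 2 w‖ < ε} ≠ 0 :=
  (isOpen_l2Ball ε).measure_ne_zero volume ⟨0, by simpa using hε⟩

instance (hn : 2 ≤ n) : IsProbabilityMeasure (stiefelHaar 𝕜 hn) :=
  Measure.isProbabilityMeasure_map (continuous_frame hn).measurable.aemeasurable

variable {h : EuclideanSpace 𝕜 (Fin n) × EuclideanSpace 𝕜 (Fin n) → Arms d n}
  {φ : Stiefel 𝕜 n → Pol d n}

lemma measurable_of_coe_eq (hh : Continuous h)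
    (hφ : ∀ p, ((φ p : Polygons d n) : Arms d n) = h p.1) : Measurable φ := by
  have hc : Continuous fun p => ((φ p : Polygons d n) : Arms d n) := by
    simp_rw [hφ]
    exact hh.comp continuous_subtype_val
  exact ((hc.subtype_mk fun p => (φ p).1.2).subtype_mk fun p => (φ p).2).measurable

theorem integral_randomDilation_stiefelHaar (hn : 2 ≤ n) [IsProbabilityMeasure (closedRadius 𝕜 n)]
    (hh : Continuous h) (hh2 : ∀ (r : ℝ) x, h (r • x) = r ^ 2 • h x)
    (hφ : ∀ p, ((φ p : Polygons d n) : Arms d n) = h p.1) (f : Arms d n →ᵇ ℝ) :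
    ∫ p, f p ∂(randomDilation ((stiefelHaar 𝕜 hn).map φ) ((closedRadius 𝕜 n).map (· ^ 2))) =
      ∫ r, ∫ U, f (h (r • (frame 𝕜 hn U : 𝔼 × 𝔼))) ∂(unitaryHaar 𝕜 n) ∂(closedRadius 𝕜 n) := by
  have hframe := (continuous_frame (𝕜 := 𝕜) hn).measurable
  have hφm := (measurable_of_coe_eq hh hφ).comp hframe
  have hM : Measurable fun p : Matrix.unitaryGroup (Fin n) 𝕜 × ℝ =>
      p.2 ^ 2 • ((φ ∘ frame 𝕜 hn) p.1 : Polygons d n) :=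
    (measurable_snd.pow_const 2).smul (measurable_subtype_coe.comp (hφm.comp measurable_fst))
  have hf : Measurable fun p : Polygons d n => f p :=
    (f.continuous.comp continuous_subtype_val).measurable
  have hint : Integrable (fun p : Matrix.unitaryGroup (Fin n) 𝕜 × ℝ =>
      f (p.2 ^ 2 • ((φ ∘ frame 𝕜 hn) p.1 : Polygons d n) : Polygons d n))
      ((unitaryHaar 𝕜 n).prod (closedRadius 𝕜 n)) :=
    Integrable.of_bound (hf.comp hM).aestronglyMeasurable ‖f‖
      (Eventually.of_forall fun _ => f.norm_coe_le_norm _)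
  rw [stiefelHaar, Measure.map_map (measurable_of_coe_eq hh hφ) hframe,
    randomDilation_map hφm (by fun_prop), integral_map hM.aemeasurable hf.aestronglyMeasurable,
    integral_prod_symm _ hint]
  simp only [Function.comp_apply, Submodule.coe_smul, hφ, hh2]

theorem isSubspaceMeasure_randomDilation (hn : 2 ≤ n)
    (hdim : Module.finrank ℝ 𝕜 + 1 < n * Module.finrank ℝ 𝕜)
    (hh : Continuous h) (hh2 : ∀ (r : ℝ) x, h (r • x) = r ^ 2 • h x)
    (hclose : ∀ x, ‖∑ i, h x i‖ = ‖WithLp.toLp 2 (closingVector x)‖)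
    (hφ : ∀ p, ((φ p : Polygons d n) : Arms d n) = h p.1) :
    IsSubspaceMeasure (((stdGaussian 𝔼).prod (stdGaussian 𝔼)).map h)
      (randomDilation ((stiefelHaar 𝕜 hn).map φ) ((closedRadius 𝕜 n).map (· ^ 2))) := by
  have : Nonempty (Fin n) := ⟨⟨0, by lia⟩⟩
  have := isProbabilityMeasure_closedRadius hdim
  have hτ : IsProbabilityMeasure ((closedRadius 𝕜 n).map (· ^ 2)) :=
    Measure.isProbabilityMeasure_map (by fun_prop)
  have hσ : IsProbabilityMeasure ((stiefelHaar 𝕜 hn).map φ) :=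
    Measure.isProbabilityMeasure_map (measurable_of_coe_eq hh hφ).aemeasurable
  refine ⟨isProbabilityMeasure_randomDilation, fun f => ?_⟩
  rw [integral_randomDilation_stiefelHaar hn hh hh2 hφ f]
  refine (tendsto_integral_cond_closingVector hn hdim (f.compContinuous ⟨h, hh⟩)
    tendsto_l2Ball_smallSets (fun ε => (isOpen_l2Ball ε).measurableSet)
    (eventually_mem_nhdsWithin.mono fun ε hε => volume_l2Ball_ne_zero hε)).congr fun ε => ?_
  have hs : MeasurableSet {e : Arms d n | ‖∑ i, e i‖ < ε} :=
    (isOpen_lt (by fun_prop) continuous_const).measurableSet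
  have hpre : h ⁻¹' {e : Arms d n | ‖∑ i, e i‖ < ε} =
      closingVector ⁻¹' {w : 𝕜 × ℝ | ‖WithLp.toLp 2 w‖ < ε} :=
    Set.ext fun x => by simp only [Set.mem_preimage, Set.mem_ofPred_eq, hclose]
  rw [cond_map hh.measurable hs, hpre, integral_map hh.measurable.aemeasurable
    f.continuous.measurable.aestronglyMeasurable]
  rfl

theorem isSubspaceMeasure_and_integral_pol (hn : 2 ≤ n)
    (hdim : Module.finrank ℝ 𝕜 + 1 < n * Module.finrank ℝ 𝕜) {μ : Measure (Arms d n)}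
    (hμ : μ = ((stdGaussian 𝔼).prod (stdGaussian 𝔼)).map h)
    (hh : Continuous h) (hh2 : ∀ (r : ℝ) x, h (r • x) = r ^ 2 • h x)
    (hclose : ∀ x, ‖∑ i, h x i‖ = ‖WithLp.toLp 2 (closingVector x)‖)
    (hφ : ∀ p, ((φ p : Polygons d n) : Arms d n) = h p.1) :
    IsSubspaceMeasure μ (subspaceMeasure μ) ∧
    ∀ F : Polygons d n → ℝ, ScaleInvariant F →
      (Integrable F (subspaceMeasure μ) ↔
        Integrable (fun p : Pol d n => F p) ((stiefelHaar 𝕜 hn).map φ)) ∧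
      ∫ p, F p ∂(subspaceMeasure μ) = ∫ p : Pol d n, F p ∂((stiefelHaar 𝕜 hn).map φ) := by
  have : Nonempty (Fin n) := ⟨⟨0, by lia⟩⟩
  have := isProbabilityMeasure_closedRadius hdim
  have hτ : IsProbabilityMeasure ((closedRadius 𝕜 n).map (· ^ 2)) :=
    Measure.isProbabilityMeasure_map (by fun_prop)
  have hτ0 : ∀ᵐ t ∂((closedRadius 𝕜 n).map (· ^ 2)), 0 < t := by
    rw [ae_map_iff (by fun_prop) measurableSet_Ioi]
    filter_upwards [ae_pos_closedRadius] with r hr using pow_pos hr 2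
  have hsub := hμ ▸ isSubspaceMeasure_randomDilation hn hdim hh hh2 hclose hφ
  rw [hsub.subspaceMeasure_eq]
  exact ⟨hsub, fun F hF => hF.integrable_and_integral_pol hτ0⟩

end ClosedPolygons

section OpenPolygons

variable {d n : ℕ} {ι : Type} [Fintype ι] [Nonempty ι]

variable (ι) in
lemma exists_stdGaussian_eq_map_uniformSphere_prod :
    ∃ ρ : Measure ℝ, IsProbabilityMeasure ρ ∧ (∀ᵐ r ∂ρ, 0 < r) ∧
      stdGaussian (EuclideanSpace ℝ ι) =
        ((uniformSphere ι).prod ρ).map fun p => p.2 • (p.1 : EuclideanSpace ℝ ι) :=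
  exists_eq_map_uniformSphere_prod (f := fun r => ENNReal.ofReal
    ((2 * Real.pi) ^ (-(Module.finrank ℝ (EuclideanSpace ℝ ι) : ℝ) / 2) * Real.exp (-r ^ 2 / 2)))
    (by fun_prop) stdGaussian_eq_withDensity

theorem integrable_and_integral_arm {h : EuclideanSpace ℝ ι → Arms d n} (hh : Measurable h)
    (hh2 : ∀ (r : ℝ) x, h (r • x) = r ^ 2 • h x)
    {φ : Metric.sphere (0 : EuclideanSpace ℝ ι) 1 → Arm d n}
    (hφ : ∀ x, (φ x : Arms d n) = h (√2 • (x : EuclideanSpace ℝ ι)))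
    {F : Arms d n → ℝ} (hF : ScaleInvariant F) :
    (Integrable F ((stdGaussian (EuclideanSpace ℝ ι)).map h) ↔
      Integrable (fun e : Arm d n => F e) ((uniformSphere ι).map φ)) ∧
    ∫ e, F e ∂((stdGaussian (EuclideanSpace ℝ ι)).map h) =
      ∫ e : Arm d n, F e ∂((uniformSphere ι).map φ) := by
  obtain ⟨ρ, hρ, hρ0, hpolar⟩ := exists_stdGaussian_eq_map_uniformSphere_prod ι
  have hφm : Measurable φ := by
    have : Measurable fun x => (φ x : Arms d n) := by
      simp_rw [hφ]
      exact hh.comp (by fun_prop)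
    exact this.subtype_mk (h := fun x => (φ x).2)
  have hlaw : (stdGaussian (EuclideanSpace ℝ ι)).map h =
      randomDilation ((uniformSphere ι).map φ) (ρ.map fun r => r ^ 2 / 2) := by
    rw [hpolar, Measure.map_map hh measurable_smul_coe, randomDilation_map hφm (by fun_prop)]
    congr 1
    funext p
    rw [Function.comp_apply, hφ, hh2, hh2, Real.sq_sqrt zero_le_two, smul_smul,
      div_mul_cancel₀ _ two_ne_zero]
  have hτ : IsProbabilityMeasure (ρ.map fun r => r ^ 2 / 2) :=
    Measure.isProbabilityMeasure_map (by fun_prop)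
  have hτ0 : ∀ᵐ t ∂(ρ.map fun r => r ^ 2 / 2), 0 < t := by
    rw [ae_map_iff (by fun_prop) measurableSet_Ioi]
    filter_upwards [hρ0] with r hr
    positivity
  rw [hlaw]
  exact hF.integrable_and_integral_arm hτ0

end OpenPolygons

section GaussianCoordinates

lemma stdGaussian_map_eq_prod {E F G : Type*} [NormedAddCommGroup E] [InnerProductSpace ℝ E]
    [FiniteDimensional ℝ E] [MeasurableSpace E] [BorelSpace E] [NormedAddCommGroup F]
    [InnerProductSpace ℝ F] [FiniteDimensional ℝ F] [MeasurableSpace F] [BorelSpace F]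
    [NormedAddCommGroup G] [InnerProductSpace ℝ G] [FiniteDimensional ℝ G] [MeasurableSpace G]
    [BorelSpace G] (f : G →ₗ[ℝ] E × F) (hnorm : ∀ x, ‖WithLp.toLp 2 (f x)‖ = ‖x‖)
    (hdim : Module.finrank ℝ G = Module.finrank ℝ E + Module.finrank ℝ F) :
    (stdGaussian G).map f = (stdGaussian E).prod (stdGaussian F) := by
  let L : G →ₗᵢ[ℝ] WithLp 2 (E × F) :=
    { toFun := fun x => WithLp.toLp 2 (f x)
      map_add' := fun x y => by rw [map_add, WithLp.toLp_add]
      map_smul' := fun r x => by rw [map_smul, WithLp.toLp_smul, RingHom.id_apply]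
      norm_map' := hnorm }
  have hrank : Module.finrank ℝ G = Module.finrank ℝ (WithLp 2 (E × F)) := by
    rw [hdim, (WithLp.linearEquiv 2 ℝ (E × F)).finrank_eq, Module.finrank_prod]
  have hL := stdGaussian_map (L.toLinearIsometryEquiv hrank)
  have hf : ⇑f = WithLp.ofLp ∘ L.toLinearIsometryEquiv hrank := rfl
  rw [hf, ← Measure.map_map (by fun_prop) (by fun_prop), hL, stdGaussian_prod,
    Measure.map_map (by fun_prop) (by fun_prop)]
  exact Measure.map_id

/-- The pair `(u, v)` of complex vectors for which `u + v j` has the given real coordinates. -/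
noncomputable def toComplexPair (n : ℕ) : EuclideanSpace ℝ (Fin n × Fin 4) →ₗ[ℝ]
    EuclideanSpace ℂ (Fin n) × EuclideanSpace ℂ (Fin n) where
  toFun x := (WithLp.toLp 2 fun m => ⟨x (m, 0), x (m, 1)⟩,
    WithLp.toLp 2 fun m => ⟨x (m, 2), x (m, 3)⟩)
  map_add' _ _ := rfl
  map_smul' r x := by
    refine Prod.ext (PiLp.ext fun m => ?_) (PiLp.ext fun m => ?_) <;>
    apply Complex.ext <;> simp

/-- The pair `(u, v)` of real vectors for which `u + v j` has the given coordinates. -/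
noncomputable def toRealPair (n : ℕ) : EuclideanSpace ℝ (Fin n × Fin 2) →ₗ[ℝ]
    EuclideanSpace ℝ (Fin n) × EuclideanSpace ℝ (Fin n) where
  toFun x := (WithLp.toLp 2 fun m => x (m, 0), WithLp.toLp 2 fun m => x (m, 1))
  map_add' _ _ := rfl
  map_smul' _ _ := rfl

variable {n : ℕ}

lemma norm_toComplexPair (x : EuclideanSpace ℝ (Fin n × Fin 4)) :
    ‖WithLp.toLp 2 (toComplexPair n x)‖ = ‖x‖ := by
  rw [← sq_eq_sq₀ (norm_nonneg _) (norm_nonneg _), WithLp.prod_norm_sq_eq_of_L2,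
    EuclideanSpace.norm_sq_eq, EuclideanSpace.norm_sq_eq, EuclideanSpace.norm_sq_eq,
    Fintype.sum_prod_type, ← Finset.sum_add_distrib]
  refine Finset.sum_congr rfl fun m _ => ?_
  change ‖(⟨x (m, 0), x (m, 1)⟩ : ℂ)‖ ^ 2 + ‖(⟨x (m, 2), x (m, 3)⟩ : ℂ)‖ ^ 2 = _
  simp only [Complex.sq_norm, Complex.normSq_apply, Real.norm_eq_abs, sq_abs, Fin.sum_univ_four]
  ring

lemma norm_toRealPair (x : EuclideanSpace ℝ (Fin n × Fin 2)) :
    ‖WithLp.toLp 2 (toRealPair n x)‖ = ‖x‖ := by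
  rw [← sq_eq_sq₀ (norm_nonneg _) (norm_nonneg _), WithLp.prod_norm_sq_eq_of_L2,
    EuclideanSpace.norm_sq_eq, EuclideanSpace.norm_sq_eq, EuclideanSpace.norm_sq_eq,
    Fintype.sum_prod_type, ← Finset.sum_add_distrib]
  refine Finset.sum_congr rfl fun m _ => ?_
  rw [Fin.sum_univ_two]
  rfl

variable (n) in
lemma stdGaussian_map_toComplexPair :
    (stdGaussian (EuclideanSpace ℝ (Fin n × Fin 4))).map (toComplexPair n) =
      (stdGaussian (EuclideanSpace ℂ (Fin n))).prod (stdGaussian (EuclideanSpace ℂ (Fin n))) := by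
  refine stdGaussian_map_eq_prod _ norm_toComplexPair ?_
  rw [finrank_euclideanSpace_real, Complex.finrank_real_complex, finrank_euclideanSpace,
    Fintype.card_prod, Fintype.card_fin, Fintype.card_fin]
  lia

variable (n) in
lemma stdGaussian_map_toRealPair :
    (stdGaussian (EuclideanSpace ℝ (Fin n × Fin 2))).map (toRealPair n) =
      (stdGaussian (EuclideanSpace ℝ (Fin n))).prod (stdGaussian (EuclideanSpace ℝ (Fin n))) := by
  refine stdGaussian_map_eq_prod _ norm_toRealPair ?_
  rw [finrank_euclideanSpace, finrank_euclideanSpace, Fintype.card_prod, Fintype.card_fin,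
    Fintype.card_fin]
  lia

end GaussianCoordinates

section HopfCoordinates

variable {n : ℕ}

lemma hopfSpace_apply (q : Fin n → ℍ[ℝ]) (m : Fin n) :
    hopfSpace q m = !₂[(q m).re ^ 2 + (q m).imI ^ 2 - (q m).imJ ^ 2 - (q m).imK ^ 2,
      2 * (q m).imI * (q m).imJ - 2 * (q m).re * (q m).imK,
      2 * (q m).re * (q m).imJ + 2 * (q m).imI * (q m).imK] := by
  obtain ⟨h1, h2, h3⟩ := hopf_coord (q m)
  rw [hopfSpace, h1, h2, h3]

lemma hopfPlane_sheetOne_apply (a b : Fin n → ℝ) (m : Fin n) :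
    hopfPlane (sheetOne a b) m = !₂[a m ^ 2 - b m ^ 2, 2 * a m * b m] := by
  obtain ⟨h1, -, h3⟩ := hopf_coord (sheetOne a b m)
  rw [hopfPlane, h1, h3]
  simp [sheetOne]

lemma hopfSpace_smul (r : ℝ) (q : Fin n → ℍ[ℝ]) : hopfSpace (r • q) = r ^ 2 • hopfSpace q := by
  funext m
  simp only [Pi.smul_apply, hopfSpace_apply]
  ext l
  fin_cases l <;> simp <;> ring

lemma hopfPlane_sheetOne_smul (r : ℝ) (a b : Fin n → ℝ) :
    hopfPlane (sheetOne (r • a) (r • b)) = r ^ 2 • hopfPlane (sheetOne a b) := by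
  funext m
  simp only [Pi.smul_apply, hopfPlane_sheetOne_apply]
  ext l
  fin_cases l <;> simp <;> ring

lemma quat_smul (r : ℝ) (x : EuclideanSpace ℝ (Fin n × Fin 4)) : quat (r • x) = r • quat x := by
  funext m
  ext <;> simp [quat] <;> rfl

lemma complexPair_smul (r : ℝ) (u v : EuclideanSpace ℂ (Fin n)) :
    complexPair (r • u) (r • v) = r • complexPair u v := by
  funext m
  ext <;> simp [complexPair] <;> rfl

variable (n) in
lemma continuous_hopfSpace_complexPair :
    Continuous fun x : EuclideanSpace ℂ (Fin n) × EuclideanSpace ℂ (Fin n) =>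
      hopfSpace (complexPair x.1 x.2) := by
  refine continuous_pi fun m => ?_
  simp only [hopfSpace_apply, complexPair]
  refine (PiLp.continuous_toLp 2 _).comp (continuous_pi fun l => ?_)
  fin_cases l <;> simp only [Fin.zero_eta, Fin.mk_one, Fin.reduceFinMk, Matrix.cons_val] <;>
    fun_prop

variable (n) in
lemma continuous_hopfPlane_sheetOne :
    Continuous fun x : EuclideanSpace ℝ (Fin n) × EuclideanSpace ℝ (Fin n) =>
      hopfPlane (sheetOne x.1 x.2) := by
  refine continuous_pi fun m => ?_
  simp only [hopfPlane_sheetOne_apply]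
  refine (PiLp.continuous_toLp 2 _).comp (continuous_pi fun l => ?_)
  fin_cases l <;> simp only [Fin.zero_eta, Fin.mk_one, Matrix.cons_val] <;> fun_prop

lemma norm_sq_eq_sum_re_im (w : EuclideanSpace ℂ (Fin n)) :
    ‖w‖ ^ 2 = ∑ m, ((w m).re ^ 2 + (w m).im ^ 2) := by
  simp only [EuclideanSpace.norm_sq_eq, Complex.sq_norm, Complex.normSq_apply, ← sq]

lemma re_inner_eq_sum (u v : EuclideanSpace ℂ (Fin n)) :
    (inner ℂ u v).re = ∑ m, ((u m).re * (v m).re + (u m).im * (v m).im) := by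
  simp [PiLp.inner_apply, mul_comm]

lemma im_inner_eq_sum (u v : EuclideanSpace ℂ (Fin n)) :
    (inner ℂ u v).im = ∑ m, ((u m).re * (v m).im - (u m).im * (v m).re) := by
  simp only [PiLp.inner_apply, Complex.im_sum]
  refine Finset.sum_congr rfl fun m _ => ?_
  simp only [RCLike.inner_apply, Complex.mul_im, Complex.conj_im, mul_neg, Complex.conj_re]
  ring

lemma sum_hopfSpace_complexPair (u v : EuclideanSpace ℂ (Fin n)) :
    ∑ m, hopfSpace (complexPair u v) m = !₂[(closingVector (u, v)).2,
      -(closingVector (u, v)).1.im, (closingVector (u, v)).1.re] := by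
  have hre : (closingVector (u, v)).1.re = 2 * (inner ℂ u v).re := by simp [closingVector]
  have him : (closingVector (u, v)).1.im = 2 * (inner ℂ u v).im := by simp [closingVector]
  rw [hre, him, re_inner_eq_sum, im_inner_eq_sum, closingVector, norm_sq_eq_sum_re_im,
    norm_sq_eq_sum_re_im, ← Finset.sum_sub_distrib, Finset.mul_sum, Finset.mul_sum,
    ← Finset.sum_neg_distrib]
  ext l
  rw [WithLp.ofLp_sum, Finset.sum_apply]
  fin_cases l <;>
  · refine Finset.sum_congr rfl fun m _ => ?_
    simp only [hopfSpace_apply, complexPair, Fin.zero_eta, Fin.mk_one, Fin.reduceFinMk,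
      Matrix.cons_val]
    ring

lemma sum_hopfPlane_sheetOne (u v : EuclideanSpace ℝ (Fin n)) :
    ∑ m, hopfPlane (sheetOne u v) m = !₂[(closingVector (u, v)).2, (closingVector (u, v)).1] := by
  rw [closingVector, EuclideanSpace.norm_sq_eq, EuclideanSpace.norm_sq_eq, PiLp.inner_apply,
    ← Finset.sum_sub_distrib, Finset.mul_sum]
  ext l
  rw [WithLp.ofLp_sum, Finset.sum_apply]
  fin_cases l <;>
  · refine Finset.sum_congr rfl fun m _ => ?_
    simp [hopfPlane_sheetOne_apply, mul_assoc, mul_comm]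

lemma norm_sum_hopfSpace_complexPair (x : EuclideanSpace ℂ (Fin n) × EuclideanSpace ℂ (Fin n)) :
    ‖∑ m, hopfSpace (complexPair x.1 x.2) m‖ = ‖WithLp.toLp 2 (closingVector x)‖ := by
  rw [sum_hopfSpace_complexPair, ← sq_eq_sq₀ (norm_nonneg _) (norm_nonneg _),
    WithLp.prod_norm_sq_eq_of_L2, EuclideanSpace.norm_sq_eq, Complex.sq_norm, Complex.normSq_apply]
  simp only [Real.norm_eq_abs, sq_abs, Fin.sum_univ_three, Matrix.cons_val, WithLp.toLp_fst,
    WithLp.toLp_snd]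
  ring

lemma norm_sum_hopfPlane_sheetOne (x : EuclideanSpace ℝ (Fin n) × EuclideanSpace ℝ (Fin n)) :
    ‖∑ m, hopfPlane (sheetOne x.1 x.2) m‖ = ‖WithLp.toLp 2 (closingVector x)‖ := by
  rw [sum_hopfPlane_sheetOne, ← sq_eq_sq₀ (norm_nonneg _) (norm_nonneg _),
    WithLp.prod_norm_sq_eq_of_L2, EuclideanSpace.norm_sq_eq]
  simp [Fin.sum_univ_two, add_comm]

end HopfCoordinates

section HopfGaussian

lemma hopfGaussianSpace_eq_map_prod (n : ℕ) :
    hopfGaussianSpace n = ((stdGaussian (EuclideanSpace ℂ (Fin n))).prod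
      (stdGaussian (EuclideanSpace ℂ (Fin n)))).map fun x => hopfSpace (complexPair x.1 x.2) := by
  rw [← stdGaussian_map_toComplexPair, Measure.map_map
    (continuous_hopfSpace_complexPair n).measurable
    (toComplexPair n).continuous_of_finiteDimensional.measurable]
  rfl

lemma hopfGaussianPlane_eq_map (n : ℕ) :
    hopfGaussianPlane n = (stdGaussian (EuclideanSpace ℝ (Fin n × Fin 2))).map
      fun z => hopfPlane (sheetOne (fun m => z (m, 0)) (fun m => z (m, 1))) := by
  simp only [hopfGaussianPlane, hopfPlane_sheetTwo, inv_two_smul_add_self]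

lemma hopfGaussianPlane_eq_map_prod (n : ℕ) :
    hopfGaussianPlane n = ((stdGaussian (EuclideanSpace ℝ (Fin n))).prod
      (stdGaussian (EuclideanSpace ℝ (Fin n)))).map fun x => hopfPlane (sheetOne x.1 x.2) := by
  rw [hopfGaussianPlane_eq_map, ← stdGaussian_map_toRealPair, Measure.map_map
    (continuous_hopfPlane_sheetOne n).measurable
    (toRealPair n).continuous_of_finiteDimensional.measurable]
  rfl

lemma symmetricArmPlane_eq_map (n : ℕ) :
    symmetricArmPlane n = (uniformSphere (Fin n × Fin 2)).map (sphereToArmPlaneOne n) := by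
  have h : sphereToArmPlaneTwo n = sphereToArmPlaneOne n :=
    funext fun x => Subtype.ext (hopfPlane_sheetTwo _ _)
  rw [symmetricArmPlane, h, inv_two_smul_add_self]

variable {n : ℕ}

lemma symmetricPolPlane_eq_map (hn : 2 ≤ n) :
    symmetricPolPlane hn = (stiefelHaar ℝ hn).map (stiefelToPolPlaneOne n) := by
  have h : stiefelToPolPlaneTwo n = stiefelToPolPlaneOne n :=
    funext fun x => Subtype.ext (Subtype.ext (hopfPlane_sheetTwo _ _))
  rw [symmetricPolPlane, h, inv_two_smul_add_self]

theorem integral_hopfGaussianSpace (hn : 1 ≤ n) {F : Arms 3 n → ℝ} (hF : ScaleInvariant F) :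
    (Integrable F (hopfGaussianSpace n) ↔
      Integrable (fun e : Arm 3 n => F e) (symmetricArmSpace n)) ∧
    ∫ e, F e ∂(hopfGaussianSpace n) = ∫ e : Arm 3 n, F e ∂(symmetricArmSpace n) := by
  have : Nonempty (Fin n × Fin 4) := ⟨⟨0, hn⟩, 0⟩
  have hcont := (continuous_hopfSpace_complexPair n).comp
    (toComplexPair n).continuous_of_finiteDimensional
  exact integrable_and_integral_arm (h := fun x => hopfSpace (quat x)) hcont.measurable
    (fun r x => by rw [quat_smul, hopfSpace_smul]) (fun _ => rfl) hF

theorem integral_hopfGaussianPlane (hn : 1 ≤ n) {F : Arms 2 n → ℝ} (hF : ScaleInvariant F) :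
    (Integrable F (hopfGaussianPlane n) ↔
      Integrable (fun e : Arm 2 n => F e) (symmetricArmPlane n)) ∧
    ∫ e, F e ∂(hopfGaussianPlane n) = ∫ e : Arm 2 n, F e ∂(symmetricArmPlane n) := by
  have : Nonempty (Fin n × Fin 2) := ⟨⟨0, hn⟩, 0⟩
  have hcont := (continuous_hopfPlane_sheetOne n).comp
    (toRealPair n).continuous_of_finiteDimensional
  rw [hopfGaussianPlane_eq_map, symmetricArmPlane_eq_map]
  exact integrable_and_integral_arm hcont.measurable
    (fun r x => hopfPlane_sheetOne_smul r (fun m => x (m, 0)) (fun m => x (m, 1)))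
    (fun _ => rfl) hF

theorem integral_subspaceMeasure_hopfGaussianSpace (hn : 2 ≤ n) :
    IsSubspaceMeasure (hopfGaussianSpace n) (subspaceMeasure (hopfGaussianSpace n)) ∧
    ∀ F : Polygons 3 n → ℝ, ScaleInvariant F →
      (Integrable F (subspaceMeasure (hopfGaussianSpace n)) ↔
        Integrable (fun p : Pol 3 n => F p) (symmetricPolSpace hn)) ∧
      ∫ p, F p ∂(subspaceMeasure (hopfGaussianSpace n)) =
        ∫ p : Pol 3 n, F p ∂(symmetricPolSpace hn) := by
  have hdim : Module.finrank ℝ ℂ + 1 < n * Module.finrank ℝ ℂ := by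
    rw [Complex.finrank_real_complex]
    lia
  refine isSubspaceMeasure_and_integral_pol hn hdim (hopfGaussianSpace_eq_map_prod n)
    (continuous_hopfSpace_complexPair n) (fun r x => ?_) norm_sum_hopfSpace_complexPair
    (fun _ => rfl)
  rw [← hopfSpace_smul, ← complexPair_smul, Prod.smul_fst, Prod.smul_snd]

theorem integral_subspaceMeasure_hopfGaussianPlane (hn : 3 ≤ n) :
    IsSubspaceMeasure (hopfGaussianPlane n) (subspaceMeasure (hopfGaussianPlane n)) ∧
    ∀ F : Polygons 2 n → ℝ, ScaleInvariant F →
      (Integrable F (subspaceMeasure (hopfGaussianPlane n)) ↔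
        Integrable (fun p : Pol 2 n => F p) (symmetricPolPlane (Nat.le_of_succ_le hn))) ∧
      ∫ p, F p ∂(subspaceMeasure (hopfGaussianPlane n)) =
        ∫ p : Pol 2 n, F p ∂(symmetricPolPlane (Nat.le_of_succ_le hn)) := by
  have hdim : Module.finrank ℝ ℝ + 1 < n * Module.finrank ℝ ℝ := by
    rw [Module.finrank_self]
    lia
  rw [symmetricPolPlane_eq_map]
  exact isSubspaceMeasure_and_integral_pol _ hdim (hopfGaussianPlane_eq_map_prod n)
    (continuous_hopfPlane_sheetOne n) (fun r x => hopfPlane_sheetOne_smul r _ _)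
    norm_sum_hopfPlane_sheetOne fun _ => rfl

end HopfGaussian

end HopfPolygon

theorem theorem2 (n : ℕ) :
    (1 ≤ n → ∀ F : HopfPolygon.Arms 3 n → ℝ, HopfPolygon.ScaleInvariant F →
      (Integrable F (HopfPolygon.hopfGaussianSpace n) ↔
        Integrable (fun e : HopfPolygon.Arm 3 n => F e) (HopfPolygon.symmetricArmSpace n)) ∧
      ∫ e, F e ∂(HopfPolygon.hopfGaussianSpace n) =
        ∫ e : HopfPolygon.Arm 3 n, F e ∂(HopfPolygon.symmetricArmSpace n)) ∧
    (1 ≤ n → ∀ F : HopfPolygon.Arms 2 n → ℝ, HopfPolygon.ScaleInvariant F →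
      (Integrable F (HopfPolygon.hopfGaussianPlane n) ↔
        Integrable (fun e : HopfPolygon.Arm 2 n => F e) (HopfPolygon.symmetricArmPlane n)) ∧
      ∫ e, F e ∂(HopfPolygon.hopfGaussianPlane n) =
        ∫ e : HopfPolygon.Arm 2 n, F e ∂(HopfPolygon.symmetricArmPlane n)) ∧
    (∀ hn : 2 ≤ n,
      HopfPolygon.IsSubspaceMeasure (HopfPolygon.hopfGaussianSpace n)
        (HopfPolygon.subspaceMeasure (HopfPolygon.hopfGaussianSpace n)) ∧
      ∀ F : HopfPolygon.Polygons 3 n → ℝ, HopfPolygon.ScaleInvariant F →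
        (Integrable F (HopfPolygon.subspaceMeasure (HopfPolygon.hopfGaussianSpace n)) ↔
          Integrable (fun p : HopfPolygon.Pol 3 n => F p) (HopfPolygon.symmetricPolSpace hn)) ∧
        ∫ p, F p ∂(HopfPolygon.subspaceMeasure (HopfPolygon.hopfGaussianSpace n)) =
          ∫ p : HopfPolygon.Pol 3 n, F p ∂(HopfPolygon.symmetricPolSpace hn)) ∧
    (∀ hn : 3 ≤ n,
      HopfPolygon.IsSubspaceMeasure (HopfPolygon.hopfGaussianPlane n)
        (HopfPolygon.subspaceMeasure (HopfPolygon.hopfGaussianPlane n)) ∧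
      ∀ F : HopfPolygon.Polygons 2 n → ℝ, HopfPolygon.ScaleInvariant F →
        (Integrable F (HopfPolygon.subspaceMeasure (HopfPolygon.hopfGaussianPlane n)) ↔
          Integrable (fun p : HopfPolygon.Pol 2 n => F p)
            (HopfPolygon.symmetricPolPlane (Nat.le_of_succ_le hn))) ∧
        ∫ p, F p ∂(HopfPolygon.subspaceMeasure (HopfPolygon.hopfGaussianPlane n)) =
          ∫ p : HopfPolygon.Pol 2 n, F p
            ∂(HopfPolygon.symmetricPolPlane (Nat.le_of_succ_le hn))) :=
  ⟨fun hn _ hF => HopfPolygon.integral_hopfGaussianSpace hn hF,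
    fun hn _ hF => HopfPolygon.integral_hopfGaussianPlane hn hF,
    fun hn => HopfPolygon.integral_subspaceMeasure_hopfGaussianSpace hn,
    fun hn => HopfPolygon.integral_subspaceMeasure_hopfGaussianPlane hn⟩
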